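/- Let $n\ge 3$ and $k\ge 0$. Let $\overline{\mathcal M}{}^n_0(\mathbb R)$ be the moduli space of stable real curves of genus $0$ with $n$ labeled marked points: its points are isomorphism classes of finite trees of bubbles (copies of $\mathbb{RP}^1$ meeting in double points, with $n$ distinct labeled marked points away from the double points and at least three marked or double points on every bubble), and its topology is the coarsest one in which all cross-ratios of marked points are continuous maps to $\mathbb{RP}^1$. For a bijective labeling of the sides of an $n$-gon (in cyclic order) by $\{1,\dots,n\}$, the associated copy of the associahedron $K_{n-1}$ in $\overline{\mathcal M}{}^n_0(\mathbb R)$ is the closure of the set of curves with a single bubble on which the marked points, taken in the order of the sides, are projectively equivalent to $0<t_1<\dots<t_{n-3}<1$ and $\infty$. Let $\mathcal G^L(n,k)$ be the set of $n$-gons with labeled sides and $k$ non-intersecting diagonals, up to the dihedral group $D_n$. An element $G\in\mathcal G^L(n,k)$ represents the codimension $k$ face of the associahedron of its labeling that consists of the curves in that associahedron which have, for every diagonal $d$ of $G$, a double point separating the labels on one side of $d$ from those on the other. The twist $\nabla_d(G)$ of $G$ along a diagonal $d$ is obtained by breaking $G$ along $d$ into two pieces, reflecting one piece (with its labels and diagonals)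 and gluing it back. If $G_1,G_2\in\mathcal G^L(n,k)$ and $G_2$ is obtained from $G_1$ by a finite sequence of twists along diagonals, $(\nabla_{d_1}\cdots\nabla_{d_r})(G_1)=G_2$, then $G_1$ and $G_2$ are identified in $\overline{\mathcal M}{}^n_0(\mathbb R)$: the faces of associahedra that they represent are the same subset of $\overline{\mathcal M}{}^n_0(\mathbb R)$. -/

import Mathlib

open scoped MatrixGroups

namespace Mosaic

noncomputable section

/-! ### The moduli space of stable real curves of genus zero

The real projective line is `OnePoint ℝ`, i.e. `ℝ ∪ {∞}`, with the action of `GL(2, ℝ)` by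
Möbius transformations (two matrices act in the same way iff they agree in `PGL(2, ℝ)`). -/

/-- A stable real curve of genus zero with `n` labeled smooth marked points: a finite tree of
bubbles (copies of the real projective line).  The vertices of the tree are the bubbles, its edges
the double points. -/
structure StableCurve (n : ℕ) where
  /-- the number of bubbles -/
  size : ℕ
  /-- the dual tree -/
  tree : SimpleGraph (Fin size)
  isTree : tree.IsTree
  /-- the bubble that carries the marked point with label `i` -/
  comp : Fin n → Fin size
  /-- the position of the marked point with label `i` on its bubble -/
  mark : Fin n → OnePoint ℝ
  /-- for adjacent bubbles `v`, `w`: the position on `v` of the double point where `v` and `w`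
  meet (the value is irrelevant if `v` and `w` are not adjacent) -/
  node : Fin size → Fin size → OnePoint ℝ
  mark_ne_mark : ∀ i j, i ≠ j → comp i = comp j → mark i ≠ mark j
  node_ne_node : ∀ v w w', tree.Adj v w → tree.Adj v w' → w ≠ w' → node v w ≠ node v w'
  mark_ne_node : ∀ i w, tree.Adj (comp i) w → mark i ≠ node (comp i) w
  /-- every bubble has at least three marked or double points -/
  stable : ∀ v, 3 ≤ {i | comp i = v}.ncard + (tree.neighborSet v).ncard

namespace StableCurve

variable {n : ℕ}

/-- Isomorphism of stable curves: an isomorphism of the trees together with a projective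
transformation on every bubble, matching marked points (with their labels) and double points. -/
def Isom (C C' : StableCurve n) : Prop :=
  ∃ (e : C.tree ≃g C'.tree) (g : Fin C.size → GL (Fin 2) ℝ),
    (∀ i, C'.comp i = e (C.comp i)) ∧
    (∀ i, C'.mark i = g (C.comp i) • C.mark i) ∧
    (∀ v w, C.tree.Adj v w → C'.node (e v) (e w) = g v • C.node v w)

theorem Isom.refl (C : StableCurve n) : C.Isom C :=
  ⟨SimpleGraph.Iso.refl, fun _ => 1, by simp, by simp, by simp⟩

theorem Isom.symm {C C' : StableCurve n} : C.Isom C' → C'.Isom C := by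
  rintro ⟨e, g, h1, h2, h3⟩
  refine ⟨e.symm, fun v => (g (e.symm v))⁻¹, fun i => ?_, fun i => ?_, fun v w hvw => ?_⟩
  · rw [h1]; simp
  · rw [h1, h2]; simp
  · have := h3 (e.symm v) (e.symm w) (e.symm.map_adj_iff.2 hvw)
    simp only [RelIso.apply_symm_apply] at this
    rw [this]; simp

theorem Isom.trans {C C' C'' : StableCurve n} : C.Isom C' → C'.Isom C'' → C.Isom C'' := by
  rintro ⟨e, g, h1, h2, h3⟩ ⟨e', g', h1', h2', h3'⟩
  refine ⟨e.trans e', fun v => g' (e v) * g v, fun i => ?_, fun i => ?_, fun v w hvw => ?_⟩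
  · rw [h1', h1]; rfl
  · rw [h2', h1, h2, mul_smul]
  · have := h3' (e v) (e w) (e.map_adj_iff.2 hvw)
    rw [h3 v w hvw] at this
    rw [mul_smul]; exact this

/-- `C.Sees v i q`: seen from the bubble `v`, the marked point with label `i` is at the position
`q`.  If it lies on `v`, this is its own position; otherwise it is the position of the
double point of `v` through which one leaves `v` on the way to the bubble that carries it. -/
def Sees (C : StableCurve n) (v : Fin C.size) (i : Fin n) (q : OnePoint ℝ) : Prop :=
  (C.comp i = v ∧ q = C.mark i) ∨
  (∃ w, C.tree.Adj v w ∧ C.tree.dist w (C.comp i) < C.tree.dist v (C.comp i) ∧ q = C.node v w)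

/-- `C.HasNode S`: the curve `C` has a double point that separates the marked points with labels
in `S` from all the others (in a tree, a bubble lies on the `v`-side of the edge `vw` iff it is
closer to `v` than to `w`). -/
def HasNode (C : StableCurve n) (S : Set (Fin n)) : Prop :=
  ∃ v w, C.tree.Adj v w ∧
    (∀ i ∈ S, C.tree.dist v (C.comp i) < C.tree.dist w (C.comp i)) ∧
    (∀ i ∉ S, C.tree.dist w (C.comp i) < C.tree.dist v (C.comp i))

theorem HasNode.compl {C : StableCurve n} {S : Set (Fin n)} (h : C.HasNode S) : C.HasNode Sᶜ := by
  obtain ⟨v, w, hvw, h1, h2⟩ := h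
  exact ⟨w, v, hvw.symm, fun i hi => h2 i hi, fun i hi => h1 i (not_not.1 hi)⟩

/-- Isomorphism of stable curves as a setoid. -/
instance setoid (n : ℕ) : Setoid (StableCurve n) :=
  ⟨Isom, Isom.refl, Isom.symm, Isom.trans⟩

end StableCurve

/-- The points of the moduli space of stable real curves of genus zero with `n` labeled points:
isomorphism classes of such curves. -/
def Mbar (n : ℕ) : Type := Quotient (StableCurve.setoid n)

/-- The set of those curves for which the cross-ratio of the marked points `i, j, k, l` lies in
`U`: on the bubble from which `i`, `j`, `k` are seen at three different positions, use the
coordinate in which these are `0`, `1`, `∞`; the cross-ratio is the position of `l`. -/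
def crossRatioPreimage {n : ℕ} (i j k l : Fin n) (U : Set (OnePoint ℝ)) : Set (Mbar n) :=
  {x | ∃ C : StableCurve n, (⟦C⟧ : Quotient (StableCurve.setoid n)) = x ∧
    ∃ (v : Fin C.size) (a b c d : OnePoint ℝ),
      C.Sees v i a ∧ C.Sees v j b ∧ C.Sees v k c ∧ C.Sees v l d ∧
      ∃ g : GL (Fin 2) ℝ, g • a = ((0 : ℝ) : OnePoint ℝ) ∧ g • b = ((1 : ℝ) : OnePoint ℝ) ∧
        g • c = OnePoint.infty ∧ g • d ∈ U}

/-- The topology of the moduli space: the coarsest one for which all cross-ratios are continuous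
(equivalently, the one induced by the embedding into a product of real projective lines that is
given by the cross-ratios). -/
instance (n : ℕ) : TopologicalSpace (Mbar n) :=
  TopologicalSpace.generateFrom
    {V | ∃ (i j k l : Fin n) (U : Set (OnePoint ℝ)), i ≠ j ∧ i ≠ k ∧ j ≠ k ∧ IsOpen U ∧
      V = crossRatioPreimage i j k l U}

/-! ### The associahedra -/

/-- The points `0 = t 0 < t 1 < ⋯ < t (n - 2) = 1` and `∞` of the real projective line, placed on
the sides `0, …, n - 1` of an `n`-gon. -/
def IsStandard {n : ℕ} (p : Fin n → OnePoint ℝ) : Prop :=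
  ∃ t : Fin n → ℝ,
    (∀ s : Fin n, s.val = 0 → t s = 0) ∧
    (∀ s : Fin n, s.val + 2 = n → t s = 1) ∧
    (∀ s s' : Fin n, s < s' → s'.val + 1 < n → t s < t s') ∧
    (∀ s : Fin n, p s = if s.val + 1 = n then OnePoint.infty else ((t s : ℝ) : OnePoint ℝ))

/-- The open cell of the moduli space given by a labeling of the sides of the `n`-gon: the
curves with one bubble whose marked points with labels `label 0, …, label (n - 1)` are
projectively equivalent to points `0 < t 1 < ⋯ < t (n - 3) < 1` and `∞`, in this order. -/
def openCell {n : ℕ} (label : Fin n ≃ Fin n) : Set (Mbar n) :=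
  {x | ∃ C : StableCurve n, (⟦C⟧ : Quotient (StableCurve.setoid n)) = x ∧ C.size = 1 ∧
    ∃ g : GL (Fin 2) ℝ, IsStandard fun s => g • C.mark (label s)}

/-- The copy of the associahedron `K_{n-1}` in the moduli space that belongs to a labeling of the
sides of the `n`-gon: the closure of the open cell. -/
def associahedron {n : ℕ} (label : Fin n ≃ Fin n) : Set (Mbar n) :=
  closure (openCell label)

/-! ### Labeled polygons with diagonals -/

/-- An `n`-gon with labeled sides and `k` non-intersecting diagonals.  Both the vertices and the
sides are numbered `0, …, n - 1` in cyclic order, the side `s` joining the vertices `s` and `s + 1`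
(modulo `n`).  The side `s` has the label `label s`.  A diagonal is given as the pair of the two
vertices that it joins, the smaller number first. -/
@[ext] structure Polygon (n k : ℕ) where
  label : Fin n ≃ Fin n
  diagonals : Finset (Fin n × Fin n)
  /-- diagonals join non-adjacent vertices -/
  nonadjacent : ∀ d ∈ diagonals, d.1.val + 2 ≤ d.2.val ∧ d.2.val + 2 ≤ d.1.val + n
  /-- diagonals do not intersect (they may share a vertex) -/
  noncrossing : ∀ d ∈ diagonals, ∀ e ∈ diagonals, ¬ (d.1 < e.1 ∧ e.1 < d.2 ∧ d.2 < e.2)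
  card_diagonals : diagonals.card = k

/-- Rotation of the numbering of the vertices, or of the sides, by one step. -/
def rot (n : ℕ) : Fin n ≃ Fin n where
  toFun s := ⟨if s.val + 1 = n then 0 else s.val + 1, by have := s.isLt; split_ifs <;> omega⟩
  invFun s := ⟨if s.val = 0 then n - 1 else s.val - 1, by have := s.isLt; split_ifs <;> omega⟩
  left_inv s := by
    have := s.isLt
    ext; grind
  right_inv s := by
    have := s.isLt
    ext; grind

/-- The effect on the sides of the reflection of the `n`-gon that maps the vertex `v` to the vertex
`n - 1 - v`: the side `n - 1` is fixed, the side `s` goes to the side `n - 2 - s` otherwise. -/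
def reflSide (n : ℕ) : Fin n ≃ Fin n where
  toFun s := ⟨if s.val + 1 = n then s.val else n - 2 - s.val,
    by have := s.isLt; split_ifs <;> omega⟩
  invFun s := ⟨if s.val + 1 = n then s.val else n - 2 - s.val,
    by have := s.isLt; split_ifs <;> omega⟩
  left_inv s := by
    have := s.isLt
    ext; grind
  right_inv s := by
    have := s.isLt
    ext; grind

/-- The reflection of the piece with the vertices `a, …, b` and the sides `a, …, b - 1`: its effect
on the sides. -/
def flipSide {n : ℕ} (a b : Fin n) : Fin n ≃ Fin n where
  toFun s := ⟨if a.val ≤ s.val ∧ s.val < b.val then a.val + b.val - 1 - s.val else s.val,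
    by have := s.isLt; have := b.isLt; split_ifs <;> omega⟩
  invFun s := ⟨if a.val ≤ s.val ∧ s.val < b.val then a.val + b.val - 1 - s.val else s.val,
    by have := s.isLt; have := b.isLt; split_ifs <;> omega⟩
  left_inv s := by
    have := s.isLt
    ext; grind
  right_inv s := by
    have := s.isLt
    ext; grind

/-- The effect of a rotation by one step on diagonals. -/
def rotDiag {n : ℕ} (d : Fin n × Fin n) : Fin n × Fin n :=
  if d.2.val + 1 = n then (rot n d.2, rot n d.1) else (rot n d.1, rot n d.2)

/-- The effect of the reflection `v ↦ n - 1 - v` of the vertices on diagonals. -/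
def reflDiag {n : ℕ} (d : Fin n × Fin n) : Fin n × Fin n := (d.2.rev, d.1.rev)

/-- The effect on diagonals of the reflection of the piece with the vertices `a, …, b`: a
diagonal `(c, e)` of this piece becomes `(a + b - e, a + b - c)`, all other diagonals stay. -/
def flipDiag {n : ℕ} (a b : Fin n) (d : Fin n × Fin n) : Fin n × Fin n :=
  if h : a.val ≤ d.1.val ∧ d.1.val ≤ d.2.val ∧ d.2.val ≤ b.val then
    (⟨a.val + b.val - d.2.val, by have := b.isLt; omega⟩,
     ⟨a.val + b.val - d.1.val, by have := b.isLt; omega⟩)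
  else d

namespace Polygon

variable {n k : ℕ}

/-- The polygon after a rotation by one step. -/
def rotate (G : Polygon n k) : Polygon n k where
  label := (rot n).symm.trans G.label
  diagonals := G.diagonals.image rotDiag
  nonadjacent := by
    simp only [Finset.forall_mem_image]
    intro d hd
    have h := G.nonadjacent d hd
    have := d.2.isLt
    unfold rotDiag
    split_ifs with h1 <;> simp only [rot, Equiv.coe_fn_mk] <;> split_ifs <;> omega
  noncrossing := by
    simp only [Finset.forall_mem_image]
    intro d hd e he
    have h := G.nonadjacent d hd
    have h' := G.nonadjacent e he
    have hc := G.noncrossing d hd e he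
    have hc' := G.noncrossing e he d hd
    have := d.2.isLt
    have := e.2.isLt
    unfold rotDiag
    simp only [Fin.lt_def] at hc hc' ⊢
    split_ifs with h1 h2 h2 <;> simp only [rot, Equiv.coe_fn_mk] <;> split_ifs <;> omega
  card_diagonals := by
    rw [Finset.card_image_of_injOn, G.card_diagonals]
    intro d hd e he hde
    have h := G.nonadjacent d hd
    have h' := G.nonadjacent e he
    have := d.2.isLt
    have := e.2.isLt
    obtain ⟨d1, d2⟩ := d
    obtain ⟨e1, e2⟩ := e
    unfold rotDiag at hde
    split_ifs at hde with h1 h2 h2 <;>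
      simp only [rot, Equiv.coe_fn_mk, Prod.mk.injEq, Fin.ext_iff] at * <;>
      grind

/-- The mirror image of the polygon. -/
def reflect (G : Polygon n k) : Polygon n k where
  label := (reflSide n).symm.trans G.label
  diagonals := G.diagonals.image reflDiag
  nonadjacent := by
    simp only [Finset.forall_mem_image]
    intro d hd
    have h := G.nonadjacent d hd
    have := d.2.isLt
    simp only [reflDiag, Fin.val_rev]
    omega
  noncrossing := by
    simp only [Finset.forall_mem_image]
    intro d hd e he
    have h := G.noncrossing e he d hd
    have := d.2.isLt
    have := e.2.isLt
    have := d.1.isLt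
    have := e.1.isLt
    simp only [reflDiag, Fin.lt_def, Fin.val_rev] at h ⊢
    omega
  card_diagonals := by
    rw [Finset.card_image_of_injective, G.card_diagonals]
    rintro ⟨d1, d2⟩ ⟨e1, e2⟩ h
    simpa [reflDiag, and_comm] using h

/-- The twist of `G` along its diagonal `d = (a, b)`: break `G` along `d`, reflect the piece with
the vertices `a, …, b` (its sides, with their labels, and its diagonals) and glue it back. -/
def twist (G : Polygon n k) (d : Fin n × Fin n) (hd : d ∈ G.diagonals) : Polygon n k where
  label := (flipSide d.1 d.2).symm.trans G.label
  diagonals := G.diagonals.image (flipDiag d.1 d.2)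
  nonadjacent := by
    simp only [Finset.forall_mem_image]
    intro e he
    have h := G.nonadjacent e he
    have := d.2.isLt
    unfold flipDiag
    split_ifs with h1 <;> (try dsimp only) <;> omega
  noncrossing := by
    simp only [Finset.forall_mem_image]
    intro e he f hf
    have h0 := G.nonadjacent d hd
    have he0 := G.nonadjacent e he
    have hf0 := G.nonadjacent f hf
    have h1 := G.noncrossing e he f hf
    have h2 := G.noncrossing f hf e he
    have h3 := G.noncrossing e he d hd
    have h4 := G.noncrossing d hd e he
    have h5 := G.noncrossing f hf d hd
    have h6 := G.noncrossing d hd f hf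
    simp only [Fin.lt_def] at h1 h2 h3 h4 h5 h6 ⊢
    unfold flipDiag
    split_ifs with h7 h8 h8 <;> (try dsimp only) <;> omega
  card_diagonals := by
    rw [Finset.card_image_of_injective, G.card_diagonals]
    refine Function.Involutive.injective (fun e => ?_)
    obtain ⟨e1, e2⟩ := e
    unfold flipDiag
    by_cases h : d.1.val ≤ e1.val ∧ e1.val ≤ e2.val ∧ e2.val ≤ d.2.val
    · simp only [h, and_self, dite_true]
      rw [dif_pos (by omega)]
      simp only [Prod.mk.injEq, Fin.ext_iff]
      omega
    · rw [dif_neg h, dif_neg h]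

/-- The labels of the sides on one side of a diagonal `d = (a, b)`, namely of the sides
`a, …, b - 1`. -/
def cutLabels (label : Fin n ≃ Fin n) (d : Fin n × Fin n) : Set (Fin n) :=
  {i | d.1 ≤ label.symm i ∧ label.symm i < d.2}

/-- The codimension `k` face of an associahedron in the moduli space that a labeled polygon with
`k` diagonals represents: the points of the associahedron belonging to the labeling that have,
for each diagonal `d`, a double point which separates the labels on one side of `d` from the
labels on the other side. -/
def face (G : Polygon n k) : Set (Mbar n) :=
  {x | x ∈ associahedron G.label ∧ ∀ d ∈ G.diagonals,
    ∃ C : StableCurve n, (⟦C⟧ : Quotient (StableCurve.setoid n)) = x ∧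
      C.HasNode (cutLabels G.label d)}

end Polygon

/-! ### Polygons up to the dihedral group -/

theorem three_le_of_size {n : ℕ} (C : StableCurve n) (h : C.size = 1) : 3 ≤ n := by
  obtain ⟨m, G, hG, comp, mark, node, h1, h2, h3, h4⟩ := C
  dsimp only at h
  subst h
  have h5 := h4 0
  have h6 : (G.neighborSet 0) = ∅ := by
    ext w
    simp only [SimpleGraph.mem_neighborSet, Set.mem_empty_iff_false, iff_false]
    intro hw
    exact hw.ne (Subsingleton.elim _ _)
  have h7 : {i | comp i = 0}.ncard ≤ n := by
    simpa using Set.ncard_le_card {i | comp i = 0}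
  rw [h6, Set.ncard_empty] at h5
  omega

theorem openCell_subset {n : ℕ} (σ ρ : Fin n ≃ Fin n)
    (hρ : 3 ≤ n → ∀ p, IsStandard p → ∃ h : GL (Fin 2) ℝ, IsStandard fun s => h • p (ρ s)) :
    openCell σ ⊆ openCell (ρ.trans σ) := by
  rintro x ⟨C, rfl, hC, g, hg⟩
  obtain ⟨h, hh⟩ := hρ (three_le_of_size C hC) _ hg
  refine ⟨C, rfl, hC, h * g, ?_⟩
  simpa only [mul_smul, Equiv.trans_apply] using hh

theorem IsStandard.reflect {n : ℕ} (hn : 3 ≤ n) {p : Fin n → OnePoint ℝ} (hp : IsStandard p) :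
    ∃ h : GL (Fin 2) ℝ, IsStandard fun s => h • p ((reflSide n).symm s) := by
  obtain ⟨t, h0, h1, h2, h3⟩ := hp
  refine ⟨Matrix.GeneralLinearGroup.mkOfDetNeZero !![-1, 1; 0, 1] (by simp),
    fun s => 1 - t ((reflSide n).symm s), fun s hs => ?_, fun s hs => ?_, fun s s' hs hs' => ?_,
    fun s => ?_⟩
  · dsimp only
    rw [h1 _ (by simp [reflSide]; split_ifs <;> omega)]; simp
  · dsimp only
    rw [h0 _ (by simp only [reflSide, Equiv.coe_fn_symm_mk]; grind)]; simp
  · have := h2 ((reflSide n).symm s') ((reflSide n).symm s)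
      (by simp only [Fin.lt_def] at *; simp [reflSide]; split_ifs <;> omega)
      (by simp only [Fin.lt_def] at *; simp [reflSide]; split_ifs <;> omega)
    linarith
  · have hs := s.isLt
    dsimp only
    rw [h3]
    by_cases h : s.val + 1 = n
    · have : ((reflSide n).symm s).val + 1 = n := by simp [reflSide, h]
      rw [if_pos this, if_pos h, OnePoint.smul_infty_eq_ite]
      simp [Matrix.GeneralLinearGroup.mkOfDetNeZero]
    · have : ((reflSide n).symm s).val + 1 ≠ n := by simp [reflSide, h]; omega
      rw [if_neg this, if_neg h, OnePoint.smul_some_eq_ite]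
      simp [Matrix.GeneralLinearGroup.mkOfDetNeZero]
      ring

theorem IsStandard.rotate {n : ℕ} (hn : 3 ≤ n) {p : Fin n → OnePoint ℝ} (hp : IsStandard p) :
    ∃ h : GL (Fin 2) ℝ, IsStandard fun s => h • p (rot n s) := by
  obtain ⟨t, h0, h1, h2, h3⟩ := hp
  have hpos : ∀ s : Fin n, s.val ≠ 0 → s.val + 1 < n → 0 < t s := fun s hs hs' => by
    have := h2 ⟨0, by omega⟩ s (by simp only [Fin.lt_def]; omega) hs'
    rwa [h0 ⟨0, by omega⟩ rfl] at this
  set a : ℝ := t ⟨1, by omega⟩ with ha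
  have ha0 : 0 < a := hpos _ (by simp) (by simp only; omega)
  refine ⟨Matrix.GeneralLinearGroup.mkOfDetNeZero !![1, -a; 1, 0] (by simp [ha0.ne']),
    fun s => if s.val + 2 = n then 1 else 1 - a / t (rot n s), fun s hs => ?_, fun s hs => ?_,
    fun s s' hs hs' => ?_, fun s => ?_⟩
  · have e : rot n s = ⟨1, by omega⟩ := by ext; simp [rot, hs]; omega
    dsimp only
    rw [if_neg (by omega), e, ← ha, div_self ha0.ne', sub_self]
  · simp [hs]
  · simp only [Fin.lt_def] at hs
    have e1 : (rot n s).val = s.val + 1 := by simp [rot]; omega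
    have e2 : (rot n s').val = s'.val + 1 := by simp [rot]; omega
    have p1 := hpos (rot n s) (by omega) (by omega)
    dsimp only
    rw [if_neg (by omega)]
    split_ifs with h
    · have := div_pos ha0 p1
      linarith
    · have := h2 (rot n s) (rot n s') (by simp only [Fin.lt_def]; omega) (by omega)
      have := div_lt_div_of_pos_left ha0 p1 this
      linarith
  · have hs := s.isLt
    dsimp only
    rw [h3]
    by_cases h : s.val + 1 = n
    · have e : (rot n s).val = 0 := by simp [rot, h]
      rw [if_neg (by omega), if_pos h, h0 _ e, OnePoint.smul_some_eq_ite]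
      simp [Matrix.GeneralLinearGroup.mkOfDetNeZero]
    · have e : (rot n s).val = s.val + 1 := by simp [rot, h]
      rw [if_neg h]
      by_cases h' : s.val + 2 = n
      · rw [if_pos (by omega), if_pos h', OnePoint.smul_infty_eq_ite]
        simp [Matrix.GeneralLinearGroup.mkOfDetNeZero]
      · have p1 := hpos (rot n s) (by omega) (by omega)
        rw [if_neg (by omega), if_neg h', OnePoint.smul_some_eq_ite]
        simp only [Matrix.GeneralLinearGroup.mkOfDetNeZero]
        simp [p1.ne']
        field_simp
        ring

theorem IsStandard.rotate_symm {n : ℕ} (hn : 3 ≤ n) {p : Fin n → OnePoint ℝ}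
    (hp : IsStandard p) : ∃ h : GL (Fin 2) ℝ, IsStandard fun s => h • p ((rot n).symm s) := by
  obtain ⟨h₁, hp₁⟩ := hp.reflect hn
  obtain ⟨h₂, hp₂⟩ := hp₁.rotate hn
  obtain ⟨h₃, hp₃⟩ := hp₂.reflect hn
  refine ⟨h₃ * h₂ * h₁, ?_⟩
  convert hp₃ using 2 with s
  have e : (rot n).symm s = (reflSide n).symm (rot n ((reflSide n).symm s)) := by
    have := s.isLt
    simp only [rot, reflSide, Equiv.coe_fn_mk, Equiv.coe_fn_symm_mk, Fin.ext_iff]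
    grind
  rw [e, mul_smul, mul_smul]

theorem associahedron_rotate {n : ℕ} (σ : Fin n ≃ Fin n) :
    associahedron ((rot n).symm.trans σ) = associahedron σ := by
  refine congrArg closure (Set.Subset.antisymm ?_ ?_)
  · have := openCell_subset ((rot n).symm.trans σ) (rot n) fun hn p hp => hp.rotate hn
    rwa [← Equiv.trans_assoc, Equiv.self_trans_symm, Equiv.refl_trans] at this
  · exact openCell_subset σ (rot n).symm fun hn p hp => hp.rotate_symm hn

theorem associahedron_reflect {n : ℕ} (σ : Fin n ≃ Fin n) :
    associahedron ((reflSide n).symm.trans σ) = associahedron σ := by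
  refine congrArg closure (Set.Subset.antisymm ?_ ?_)
  · have := openCell_subset ((reflSide n).symm.trans σ) (reflSide n).symm
      fun hn p hp => hp.reflect hn
    rwa [← Equiv.trans_assoc, show (reflSide n).symm.trans (reflSide n).symm = Equiv.refl _ from
      (reflSide n).self_trans_symm, Equiv.refl_trans] at this
  · exact openCell_subset σ (reflSide n).symm fun hn p hp => hp.reflect hn

namespace Polygon

variable {n k : ℕ}

theorem cutLabels_rotDiag (σ : Fin n ≃ Fin n) (d : Fin n × Fin n) (hd : d.1 < d.2) :
    cutLabels ((rot n).symm.trans σ) (rotDiag d) =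
      if d.2.val + 1 = n then (cutLabels σ d)ᶜ else cutLabels σ d := by
  ext i
  have h1 := d.2.isLt
  have h2 := (σ.symm i).isLt
  simp only [Fin.lt_def] at hd
  split_ifs with h
  · simp only [cutLabels, rotDiag, h, if_true, rot, Set.mem_ofPred_eq, Set.mem_compl_iff,
      Equiv.symm_trans_apply, Equiv.symm_symm, Equiv.coe_fn_mk, Fin.le_def, Fin.lt_def]
    grind
  · simp only [cutLabels, rotDiag, h, if_false, rot, Set.mem_ofPred_eq,
      Equiv.symm_trans_apply, Equiv.symm_symm, Equiv.coe_fn_mk, Fin.le_def, Fin.lt_def]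
    grind

theorem cutLabels_reflDiag (σ : Fin n ≃ Fin n) (d : Fin n × Fin n) (hd : d.1 < d.2) :
    cutLabels ((reflSide n).symm.trans σ) (reflDiag d) = cutLabels σ d := by
  ext i
  have h1 := d.2.isLt
  have h2 := (σ.symm i).isLt
  simp only [Fin.lt_def] at hd
  simp only [cutLabels, reflDiag, reflSide, Set.mem_ofPred_eq, Fin.val_rev,
      Equiv.symm_trans_apply, Equiv.symm_symm, Equiv.coe_fn_mk, Fin.le_def, Fin.lt_def]
  grind

theorem face_rotate (G : Polygon n k) : G.rotate.face = G.face := by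
  ext x
  refine and_congr (by rw [rotate, associahedron_rotate]) ?_
  simp only [rotate, Finset.forall_mem_image]
  refine forall₂_congr fun d hd => exists_congr fun C => and_congr_right fun _ => ?_
  have h := G.nonadjacent d hd
  rw [cutLabels_rotDiag _ _ (by simp only [Fin.lt_def]; omega)]
  split_ifs
  · exact ⟨fun h => by simpa using h.compl, fun h => h.compl⟩
  · rfl

theorem face_reflect (G : Polygon n k) : G.reflect.face = G.face := by
  ext x
  refine and_congr (by rw [reflect, associahedron_reflect]) ?_
  simp only [reflect, Finset.forall_mem_image]
  refine forall₂_congr fun d hd => exists_congr fun C => and_congr_right fun _ => ?_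
  have h := G.nonadjacent d hd
  rw [cutLabels_reflDiag _ _ (by simp only [Fin.lt_def]; omega)]

/-- Labeled polygons with diagonals are considered up to the action of the dihedral group, which is
generated by the rotation by one step and a reflection. -/
def DihedralStep (G H : Polygon n k) : Prop := H = G.rotate ∨ H = G.reflect

end Polygon

/-- The set of `n`-gons with labeled sides and `k` non-intersecting diagonals, up to the action of
the dihedral group. -/
def LabeledPolygon (n k : ℕ) : Type := Quot (Polygon.DihedralStep (n := n) (k := k))

namespace LabeledPolygon

variable {n k : ℕ}

/-- The codimension `k` face of an associahedron in the moduli space that a labeled polygon with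
`k` diagonals represents. -/
def face : LabeledPolygon n k → Set (Mbar n) :=
  Quot.lift Polygon.face (by
    rintro G H (rfl | rfl)
    · exact G.face_rotate.symm
    · exact G.face_reflect.symm)

/-- `H` is obtained from `G` by a twist along one of its diagonals. -/
def IsTwist (G H : LabeledPolygon n k) : Prop :=
  ∃ (P : Polygon n k) (d : Fin n × Fin n) (hd : d ∈ P.diagonals),
    G = Quot.mk _ P ∧ H = Quot.mk _ (P.twist d hd)

end LabeledPolygon

end

end Mosaic

/-! By induction on the sequence, it suffices to treat one twist, along a diagonal `d` that cuts off
the labels `S`. As diagonals do not cross, the twist does not change the sets of labels they cut off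
(`cutLabels_flipDiag`), so the conditions on double points agree. What remains is
`mem_associahedron_flip`: a curve `C` in the closure of a cell, with a double point separating `S`
from its complement, is also in the closure of the cell whose block `S` is reversed.

Approximate `C` by one-bubble configurations in the cell. Put a suitable point of `S` at `0` and the
last side at `∞`; write the positions as `r` on `S` and as `1 / r` off `S`. The double point forces
`r s * r o → 0` for `s ∈ S`, `o ∉ S` (`tendsto_mul_of_hasNode`): the points of `S` cluster near `0`
relative to the others. Now apply `t ↦ -t` to the points of `S` only. Eventually they overtake no
other point, so exactly their block is reversed and the new configuration lies in the twisted cell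
(`exists_isStandard_negateSplitPoints`).

The limit is still `C` (`exists_smul_tendsto_of_hasNode`). Seen from a bubble on the `S`-side, all
other points merge at one position, so after undoing the sign globally the change is invisible; the
other side follows by the symmetry `t ↦ 1 / t`. As the topology is generated by cross-ratios, it is
enough to check this bubble by bubble (`tendsto_mkOneBubble`). The twist is an involution on
labelings, which gives the opposite inclusion. -/

namespace Mosaic

/-! ### Homogeneous coordinates and cross-ratios on the real projective line. -/

open Filter Topology

/-- The point of the real projective line with the homogeneous coordinates `[a : b]`. -/
noncomputable def homog (a b : ℝ) : OnePoint ℝ :=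
  if b = 0 then OnePoint.infty else ((a / b : ℝ) : OnePoint ℝ)

theorem homog_zero_right (a : ℝ) : homog a 0 = OnePoint.infty := if_pos rfl

theorem homog_one_right (a : ℝ) : homog a 1 = (a : OnePoint ℝ) := by simp [homog]

/-- The coordinates may both vanish, because `homog 0 0` is `∞` too. Hence rescaling arguments also
cover degenerate cross-ratios. -/
theorem homog_mul {c : ℝ} (hc : c ≠ 0) (a b : ℝ) : homog (c * a) (c * b) = homog a b := by
  unfold homog
  by_cases hb : b = 0
  · simp [hb]
  · rw [if_neg hb, if_neg (mul_ne_zero hc hb), mul_div_mul_left _ _ hc]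

theorem homog_eq_homog_iff {a b c d : ℝ} (h : a ≠ 0 ∨ b ≠ 0) (h' : c ≠ 0 ∨ d ≠ 0) :
    homog a b = homog c d ↔ a * d - b * c = 0 := by
  unfold homog
  by_cases hb : b = 0 <;> by_cases hd : d = 0
  · simp [hb, hd]
  · subst hb
    simp_all
  · subst hd
    simp_all
  · rw [if_neg hb, if_neg hd, OnePoint.coe_eq_coe, div_eq_div_iff hb hd, sub_eq_zero, mul_comm b]

theorem exists_homog (q : OnePoint ℝ) : ∃ a b : ℝ, (a ≠ 0 ∨ b ≠ 0) ∧ q = homog a b := by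
  induction q using OnePoint.rec with
  | infty => exact ⟨1, 0, by simp, (homog_zero_right _).symm⟩
  | coe t => exact ⟨t, 1, by simp, (homog_one_right _).symm⟩

theorem smul_homog (g : GL (Fin 2) ℝ) {a b : ℝ} (h : a ≠ 0 ∨ b ≠ 0) :
    g • homog a b = homog (g 0 0 * a + g 0 1 * b) (g 1 0 * a + g 1 1 * b) := by
  by_cases hb : b = 0
  · subst hb
    have ha : a ≠ 0 := by simpa using h
    rw [homog_zero_right, OnePoint.smul_infty_eq_ite]
    unfold homog
    by_cases hg : g 1 0 = 0
    · simp [hg]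
    · simp only [mul_zero, add_zero, mul_eq_zero, hg, ha, or_self, if_false]
      rw [mul_div_mul_right _ _ ha]
  · have e : homog a b = ((a / b : ℝ) : OnePoint ℝ) := if_neg hb
    rw [e, OnePoint.smul_some_eq_ite]
    unfold homog
    have e1 : g 1 0 * (a / b) + g 1 1 = (g 1 0 * a + g 1 1 * b) / b := by field_simp
    have e2 : g 0 0 * (a / b) + g 0 1 = (g 0 0 * a + g 0 1 * b) / b := by field_simp
    rw [e1, e2]
    by_cases h0 : g 1 0 * a + g 1 1 * b = 0
    · simp [h0]
    · rw [if_neg (div_ne_zero h0 hb), if_neg h0, div_div_div_cancel_right₀ hb]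

theorem smul_coords_ne_zero (g : GL (Fin 2) ℝ) {a b : ℝ} (h : a ≠ 0 ∨ b ≠ 0) :
    g 0 0 * a + g 0 1 * b ≠ 0 ∨ g 1 0 * a + g 1 1 * b ≠ 0 := by
  by_contra! h0
  have hd := g.det_ne_zero
  rw [Matrix.det_fin_two] at hd
  rcases h with h | h
  · apply mul_ne_zero hd h
    linear_combination g 1 1 * h0.1 - g 0 1 * h0.2
  · apply mul_ne_zero hd h
    linear_combination g 0 0 * h0.2 - g 1 0 * h0.1

/-- At `b₀ = 0`, dividing by `a` gives `homog 1 (b / a)`, and the claim becomes `t⁻¹ → ∞` as `t →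
0`. -/
theorem tendsto_homog {Y : Type*} {F : Filter Y} {a b : Y → ℝ} {a₀ b₀ : ℝ}
    (ha : Tendsto a F (𝓝 a₀)) (hb : Tendsto b F (𝓝 b₀)) (h : a₀ ≠ 0 ∨ b₀ ≠ 0) :
    Tendsto (fun y => homog (a y) (b y)) F (𝓝 (homog a₀ b₀)) := by
  by_cases h0 : b₀ = 0
  · have ha0 : a₀ ≠ 0 := by simpa [h0] using h
    have hc : Tendsto (homog 1) (𝓝 0) (𝓝 OnePoint.infty) := by
      have : ContinuousAt (homog 1) 0 := by
        rw [continuousAt_iff_punctured_nhds, homog_zero_right]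
        have h1 : Tendsto (fun t : ℝ => ((t⁻¹ : ℝ) : OnePoint ℝ)) (𝓝[≠] 0)
            (𝓝 OnePoint.infty) := by
          refine OnePoint.tendsto_coe_infty.comp ?_
          rw [coclosedCompact_eq_cocompact, ← Metric.cobounded_eq_cocompact]
          exact tendsto_inv₀_nhdsNE_zero
        refine h1.congr' ?_
        filter_upwards [self_mem_nhdsWithin] with t ht
        have ht : t ≠ 0 := ht
        simp [homog, ht]
      simpa [ContinuousAt, homog_zero_right] using this
    rw [h0, homog_zero_right]
    have hd : Tendsto (fun y => b y / a y) F (𝓝 0) := by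
      have := hb.div ha ha0
      rwa [h0, zero_div] at this
    refine (hc.comp hd).congr' ?_
    filter_upwards [ha.eventually_ne ha0] with y hy
    simp only [Function.comp]
    rw [← homog_mul hy, mul_one, mul_div_cancel₀ _ hy]
  · have e : homog a₀ b₀ = ((a₀ / b₀ : ℝ) : OnePoint ℝ) := if_neg h0
    rw [e]
    refine ((OnePoint.continuous_coe.tendsto _).comp (ha.div hb h0)).congr' ?_
    filter_upwards [hb.eventually_ne h0] with y hy
    simp [homog, hy]

/-- Coordinates continuous at the limit are `[1 : t⁻¹]` near `∞` and `[t : 1]` near a finite point.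
They turn limits on the projective line into limits of real numbers. -/
theorem exists_homog_of_tendsto {Y : Type*} {F : Filter Y} {f : Y → OnePoint ℝ} {q : OnePoint ℝ}
    (hf : Tendsto f F (𝓝 q)) :
    ∃ (a b : Y → ℝ) (a₀ b₀ : ℝ), (∀ y, a y ≠ 0 ∨ b y ≠ 0) ∧ (∀ y, f y = homog (a y) (b y)) ∧
      Tendsto a F (𝓝 a₀) ∧ Tendsto b F (𝓝 b₀) ∧ (a₀ ≠ 0 ∨ b₀ ≠ 0) ∧ q = homog a₀ b₀ := by
  have key : ∃ u w : OnePoint ℝ → ℝ, (∀ p, u p ≠ 0 ∨ w p ≠ 0) ∧ (∀ p, p = homog (u p) (w p)) ∧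
      ContinuousAt u q ∧ ContinuousAt w q := by
    induction q using OnePoint.rec with
    | infty =>
      -- The separate values at `t = 0` represent that point correctly where `t⁻¹` has a default
      -- value; they do not affect continuity at `∞`.
      refine ⟨fun p => p.elim 1 fun t => if t = 0 then 0 else 1,
        fun p => p.elim 0 fun t => if t = 0 then 1 else t⁻¹, fun p => ?_, fun p => ?_, ?_, ?_⟩
      · induction p using OnePoint.rec with
        | infty => simp
        | coe t => by_cases ht : t = 0 <;> simp [ht]
      · induction p using OnePoint.rec with
        | infty => simp [homog]
        | coe t => by_cases ht : t = 0 <;> simp [ht, homog]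
      · rw [OnePoint.continuousAt_infty', coclosedCompact_eq_cocompact,
          ← Metric.cobounded_eq_cocompact]
        refine tendsto_const_nhds.congr' ?_
        filter_upwards [Bornology.eventually_ne_cobounded 0] with t ht
        simp [ht]
      · rw [OnePoint.continuousAt_infty', coclosedCompact_eq_cocompact,
          ← Metric.cobounded_eq_cocompact]
        refine tendsto_inv₀_cobounded.congr' ?_
        filter_upwards [Bornology.eventually_ne_cobounded 0] with t ht
        simp [ht]
    | coe t =>
      refine ⟨fun p => p.elim 1 id, fun p => p.elim 0 fun _ => 1, fun p => ?_, fun p => ?_, ?_, ?_⟩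
      · induction p using OnePoint.rec <;> simp
      · induction p using OnePoint.rec <;> simp [homog]
      · rw [OnePoint.continuousAt_coe]
        exact continuousAt_id
      · rw [OnePoint.continuousAt_coe]
        exact continuousAt_const
  obtain ⟨u, w, h1, h2, h3, h4⟩ := key
  exact ⟨fun y => u (f y), fun y => w (f y), u q, w q, fun y => h1 _, fun y => h2 _,
    h3.tendsto.comp hf, h4.tendsto.comp hf, h1 q, h2 q⟩

/-- A numerator of a point of the projective line. -/
noncomputable def num (q : OnePoint ℝ) : ℝ := q.elim 1 id

/-- A denominator of a point of the projective line. -/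
noncomputable def den (q : OnePoint ℝ) : ℝ := q.elim 0 fun _ => 1

theorem exists_num_den_homog {a b : ℝ} (h : a ≠ 0 ∨ b ≠ 0) :
    ∃ c : ℝ, c ≠ 0 ∧ num (homog a b) = c * a ∧ den (homog a b) = c * b := by
  by_cases hb : b = 0
  · subst hb
    have ha : a ≠ 0 := by simpa using h
    exact ⟨a⁻¹, inv_ne_zero ha, by simp [homog, num, ha], by simp [homog, den]⟩
  · exact ⟨b⁻¹, inv_ne_zero hb, by simp [homog, num, hb]; ring, by simp [homog, den, hb]⟩

/-- The cross-ratio: the image of `d` under the projective transformation that maps `a`, `b`, `c`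
to `0`, `1`, `∞`. -/
noncomputable def crossRatio (a b c d : OnePoint ℝ) : OnePoint ℝ :=
  homog ((num d * den a - den d * num a) * (num b * den c - den b * num c))
    ((num d * den c - den d * num c) * (num b * den a - den b * num a))

/-- Each point enters numerator and denominator once, so rescaling its coordinates multiplies both
by the same factor. -/
theorem crossRatio_homog {a a' b b' c c' d d' : ℝ} (ha : a ≠ 0 ∨ a' ≠ 0) (hb : b ≠ 0 ∨ b' ≠ 0)
    (hc : c ≠ 0 ∨ c' ≠ 0) (hd : d ≠ 0 ∨ d' ≠ 0) :
    crossRatio (homog a a') (homog b b') (homog c c') (homog d d') =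
      homog ((d * a' - d' * a) * (b * c' - b' * c)) ((d * c' - d' * c) * (b * a' - b' * a)) := by
  obtain ⟨s, hs, e1, e2⟩ := exists_num_den_homog ha
  obtain ⟨t, ht, e3, e4⟩ := exists_num_den_homog hb
  obtain ⟨u, hu, e5, e6⟩ := exists_num_den_homog hc
  obtain ⟨v, hv, e7, e8⟩ := exists_num_den_homog hd
  unfold crossRatio
  rw [e1, e2, e3, e4, e5, e6, e7, e8, eq_comm,
    ← homog_mul (mul_ne_zero (mul_ne_zero hs ht) (mul_ne_zero hu hv))]
  congr 1 <;> ring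

/-- Every minor is multiplied by `det g`, so numerator and denominator both gain its square. -/
theorem crossRatio_smul (g : GL (Fin 2) ℝ) (a b c d : OnePoint ℝ) :
    crossRatio (g • a) (g • b) (g • c) (g • d) = crossRatio a b c d := by
  obtain ⟨a, a', ha, rfl⟩ := exists_homog a
  obtain ⟨b, b', hb, rfl⟩ := exists_homog b
  obtain ⟨c, c', hc, rfl⟩ := exists_homog c
  obtain ⟨d, d', hd, rfl⟩ := exists_homog d
  rw [smul_homog g ha, smul_homog g hb, smul_homog g hc, smul_homog g hd,
    crossRatio_homog (smul_coords_ne_zero g ha) (smul_coords_ne_zero g hb)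
      (smul_coords_ne_zero g hc) (smul_coords_ne_zero g hd), crossRatio_homog ha hb hc hd]
  have hg := g.det_ne_zero
  rw [eq_comm, ← homog_mul (pow_ne_zero 2 hg), Matrix.det_fin_two]
  congr 1 <;> ring

theorem crossRatio_zero_one_infty (d : OnePoint ℝ) :
    crossRatio ((0 : ℝ) : OnePoint ℝ) ((1 : ℝ) : OnePoint ℝ) OnePoint.infty d = d := by
  obtain ⟨d, d', hd, rfl⟩ := exists_homog d
  rw [← homog_one_right, ← homog_one_right, ← homog_zero_right 1,
    crossRatio_homog (by simp) (by simp) (by simp) hd, ← homog_mul (c := -1) (by simp) d]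
  congr 1 <;> ring

theorem smul_eq_crossRatio {g : GL (Fin 2) ℝ} {a b c : OnePoint ℝ}
    (ha : g • a = ((0 : ℝ) : OnePoint ℝ)) (hb : g • b = ((1 : ℝ) : OnePoint ℝ))
    (hc : g • c = OnePoint.infty) (d : OnePoint ℝ) : g • d = crossRatio a b c d := by
  rw [← crossRatio_smul g, ha, hb, hc, crossRatio_zero_one_infty]

theorem exists_smul_eq_zero_one_infty {a b c : OnePoint ℝ} (hab : a ≠ b) (hac : a ≠ c)
    (hbc : b ≠ c) : ∃ g : GL (Fin 2) ℝ, g • a = ((0 : ℝ) : OnePoint ℝ) ∧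
      g • b = ((1 : ℝ) : OnePoint ℝ) ∧ g • c = OnePoint.infty := by
  obtain ⟨a, a', ha, rfl⟩ := exists_homog a
  obtain ⟨b, b', hb, rfl⟩ := exists_homog b
  obtain ⟨c, c', hc, rfl⟩ := exists_homog c
  rw [Ne, homog_eq_homog_iff ha hb] at hab
  rw [Ne, homog_eq_homog_iff ha hc] at hac
  rw [Ne, homog_eq_homog_iff hb hc] at hbc
  have hba : b * a' - b' * a ≠ 0 := fun h => hab (by linear_combination -h)
  -- The rows are the linear forms vanishing at `a` and at `c`, scaled to take the same value at
  -- `b`.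
  let M : Matrix (Fin 2) (Fin 2) ℝ := !![(b * c' - b' * c) * a', -((b * c' - b' * c) * a);
    (b * a' - b' * a) * c', -((b * a' - b' * a) * c)]
  have hM : M.det ≠ 0 := by
    have : M.det = (b * c' - b' * c) * (b * a' - b' * a) * (a * c' - a' * c) := by
      simp only [M, Matrix.det_fin_two_of]; ring
    rw [this]
    exact mul_ne_zero (mul_ne_zero hbc hba) hac
  refine ⟨Matrix.GeneralLinearGroup.mkOfDetNeZero M hM, ?_, ?_, ?_⟩
  · rw [smul_homog _ ha, ← homog_one_right, homog_eq_homog_iff (smul_coords_ne_zero _ ha)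
      (by simp)]
    simp [Matrix.GeneralLinearGroup.mkOfDetNeZero, M]; ring
  · rw [smul_homog _ hb, ← homog_one_right, homog_eq_homog_iff (smul_coords_ne_zero _ hb)
      (by simp)]
    simp [Matrix.GeneralLinearGroup.mkOfDetNeZero, M]; ring
  · rw [smul_homog _ hc, ← homog_zero_right 1, homog_eq_homog_iff (smul_coords_ne_zero _ hc)
      (by simp)]
    simp [Matrix.GeneralLinearGroup.mkOfDetNeZero, M]; ring

/-- The point `d` is arbitrary: an indeterminate limit `[0 : 0]` would make it equal to both `a` and
`c`. -/
theorem tendsto_crossRatio {Y : Type*} {F : Filter Y} {p q r s : Y → OnePoint ℝ}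
    {a b c d : OnePoint ℝ} (hp : Tendsto p F (𝓝 a)) (hq : Tendsto q F (𝓝 b))
    (hr : Tendsto r F (𝓝 c)) (hs : Tendsto s F (𝓝 d)) (hab : a ≠ b) (hac : a ≠ c) (hbc : b ≠ c) :
    Tendsto (fun y => crossRatio (p y) (q y) (r y) (s y)) F (𝓝 (crossRatio a b c d)) := by
  obtain ⟨p, p', a, a', p1, p2, p3, p4, ha, rfl⟩ := exists_homog_of_tendsto hp
  obtain ⟨q, q', b, b', q1, q2, q3, q4, hb, rfl⟩ := exists_homog_of_tendsto hq
  obtain ⟨r, r', c, c', r1, r2, r3, r4, hc, rfl⟩ := exists_homog_of_tendsto hr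
  obtain ⟨s, s', d, d', s1, s2, s3, s4, hd, rfl⟩ := exists_homog_of_tendsto hs
  simp_rw [p2, q2, r2, s2, crossRatio_homog (p1 _) (q1 _) (r1 _) (s1 _),
    crossRatio_homog ha hb hc hd]
  refine tendsto_homog
    (.mul (.sub (s3.mul p4) (s4.mul p3)) (.sub (q3.mul r4) (q4.mul r3)))
    (.mul (.sub (s3.mul r4) (s4.mul r3)) (.sub (q3.mul p4) (q4.mul p3))) ?_
  by_contra! h
  have hbc' := mt (homog_eq_homog_iff hb hc).2 hbc
  have hab' := mt (homog_eq_homog_iff hb ha).2 hab.symm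
  have h1 := (homog_eq_homog_iff hd ha).2 ((mul_eq_zero.1 h.1).resolve_right hbc')
  have h2 := (homog_eq_homog_iff hd hc).2 ((mul_eq_zero.1 h.2).resolve_right hab')
  exact hac (h1.symm.trans h2)

end Mosaic

namespace Mosaic

/-! ### Distances in trees and the two sides of an edge. -/

section Tree

variable {V : Type*} {G : SimpleGraph V}

/-- Adjacent vertices of a tree are never equidistant from a third one, so an edge splits the
vertices into two sides. -/
theorem dist_lt_or_dist_lt_of_adj (hG : G.IsTree) {v w : V} (h : G.Adj v w) (x : V) :
    G.dist v x < G.dist w x ∨ G.dist w x < G.dist v x := by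
  have := hG.dist_ne_of_adj x h
  rw [G.dist_comm, G.dist_comm (u := x)] at this
  omega

theorem dist_eq_succ_of_lt (hG : G.IsTree) {v w x : V} (h : G.Adj v w)
    (hlt : G.dist v x < G.dist w x) : G.dist w x = G.dist v x + 1 := by
  have := hG.dist_eq_dist_add_one_of_adj x h
  rw [G.dist_comm, G.dist_comm (u := x)] at this
  omega

theorem exists_adj_dist_lt (hG : G.IsTree) {v x : V} (h : v ≠ x) :
    ∃ w, G.Adj v w ∧ G.dist w x < G.dist v x := by
  obtain ⟨p, hp⟩ := hG.connected.exists_walk_length_eq_dist v x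
  cases p with
  | nil => exact absurd rfl h
  | cons hvw q =>
    refine ⟨_, hvw, ?_⟩
    have := G.dist_le q
    rw [SimpleGraph.Walk.length_cons] at hp
    omega

/-- A shortest walk continued from such a neighbour is a path, and paths in a tree are unique; the
neighbour is the second vertex of the path to `x`. -/
theorem eq_of_adj_of_dist_lt (hG : G.IsTree) {v w w' x : V} (h : G.Adj v w) (h' : G.Adj v w')
    (hlt : G.dist w x < G.dist v x) (hlt' : G.dist w' x < G.dist v x) : w = w' := by
  have key : ∀ u, G.Adj v u → G.dist u x < G.dist v x → ∀ p : G.Walk v x, p.IsPath →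
      u = p.snd := by
    intro u hu hl p hp
    obtain ⟨q, hq⟩ := hG.connected.exists_walk_length_eq_dist u x
    have hc : (SimpleGraph.Walk.cons hu q).IsPath := by
      refine SimpleGraph.Walk.isPath_of_length_eq_dist _ ?_
      rw [SimpleGraph.Walk.length_cons, hq, dist_eq_succ_of_lt hG hu.symm hl]
    rw [(hG.existsUnique_path v x).unique hp hc]
    simp
  obtain ⟨p, hp, -⟩ := hG.existsUnique_path v x
  rw [key w h hlt p hp, key w' h' hlt' p hp]

/-- The only edge between the two sides of an edge of a tree is this edge itself. -/
theorem eq_of_adj_of_sides (hG : G.IsTree) {v w x y : V} (hvw : G.Adj v w) (hxy : G.Adj x y)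
    (hx : G.dist v x < G.dist w x) (hy : G.dist w y < G.dist v y) : x = v ∧ y = w := by
  have h1 := dist_eq_succ_of_lt hG hvw hx
  have h2 := dist_eq_succ_of_lt hG hvw.symm hy
  have h3 := hG.dist_eq_dist_add_one_of_adj v hxy
  have h4 := hG.dist_eq_dist_add_one_of_adj w hxy
  by_cases h0 : G.dist v x = 0
  · exact ⟨((hG.connected.dist_eq_zero_iff).1 h0).symm,
      ((hG.connected.dist_eq_zero_iff).1 (by omega)).symm⟩
  · exfalso
    -- The step `z` from `x` towards `v` and the step `y` across both approach `w`, so they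
    -- coincide, although `z` is closer to `v` than `x` and `y` is farther.
    obtain ⟨z, hz, hz'⟩ := exists_adj_dist_lt hG (v := x) (x := v) (by rintro rfl; simp at h0)
    have h5 := hG.connected.dist_triangle (u := w) (v := v) (w := z)
    have h6 : G.dist w v = 1 := SimpleGraph.dist_eq_one_iff_adj.2 hvw.symm
    have c1 := G.dist_comm (u := v) (v := z)
    have c2 := G.dist_comm (u := v) (v := x)
    have : z = y := eq_of_adj_of_dist_lt hG (x := w) hz hxy
      (by rw [G.dist_comm, G.dist_comm (u := x)]; omega)
      (by rw [G.dist_comm, G.dist_comm (u := x)]; omega)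
    subst this
    omega

/-- Any walk from one side to the other uses the edge `vw`, hence passes through `w`; the induction
locates the crossing. -/
theorem dist_add_dist_le_of_sides (hG : G.IsTree) {v w x y : V} (hvw : G.Adj v w)
    (hx : G.dist v x < G.dist w x) (hy : G.dist w y < G.dist v y) :
    G.dist x w + G.dist w y ≤ G.dist x y := by
  obtain ⟨p, hp⟩ := hG.connected.exists_walk_length_eq_dist x y
  rw [← hp]
  clear hp
  induction p with
  | nil => omega
  | @cons x u y hxu q ih =>
    rw [SimpleGraph.Walk.length_cons]
    rcases dist_lt_or_dist_lt_of_adj hG hvw u with hu | hu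
    · have h1 := ih hu hy
      have h2 := hG.connected.dist_triangle (u := x) (v := u) (w := w)
      have h3 : G.dist x u = 1 := SimpleGraph.dist_eq_one_iff_adj.2 hxu
      omega
    · obtain ⟨rfl, rfl⟩ := eq_of_adj_of_sides hG hvw hxu hx hu
      have h3 : G.dist x u = 1 := SimpleGraph.dist_eq_one_iff_adj.2 hxu
      have := G.dist_le q
      omega

/-- From all vertices beyond an edge `vw` of a tree, one sees the edge in the same direction. -/
theorem dist_lt_of_sides (hG : G.IsTree) {v w x u y : V} (hvw : G.Adj v w)
    (hx : G.dist v x < G.dist w x) (hu : G.dist u w < G.dist x w)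
    (hy : G.dist w y < G.dist v y) : G.dist u y < G.dist x y := by
  have h1 := dist_add_dist_le_of_sides hG hvw hx hy
  have h2 := hG.connected.dist_triangle (u := u) (v := w) (w := y)
  omega

theorem Iso.dist_eq {V' : Type*} {G' : SimpleGraph V'} (hG : G.Connected) (hG' : G'.Connected)
    (e : G ≃g G') (v w : V) : G'.dist (e v) (e w) = G.dist v w := by
  refine le_antisymm ?_ ?_
  · obtain ⟨p, hp⟩ := hG.exists_walk_length_eq_dist v w
    have := G'.dist_le (p.map e.toHom)
    rw [SimpleGraph.Walk.length_map, hp] at this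
    exact this
  · obtain ⟨p, hp⟩ := hG'.exists_walk_length_eq_dist (e v) (e w)
    have := G.dist_le ((p.map e.symm.toHom).copy (e.symm_apply_apply v) (e.symm_apply_apply w))
    rw [SimpleGraph.Walk.length_copy, SimpleGraph.Walk.length_map, hp] at this
    exact this

end Tree

/-! ### What is seen from the bubbles of a stable curve. -/

namespace StableCurve

variable {n : ℕ} (C : StableCurve n)

theorem exists_sees (v : Fin C.size) (i : Fin n) : ∃ q, C.Sees v i q := by
  by_cases h : C.comp i = v
  · exact ⟨_, Or.inl ⟨h, rfl⟩⟩
  · obtain ⟨w, h1, h2⟩ := exists_adj_dist_lt C.isTree (Ne.symm h)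
    exact ⟨_, Or.inr ⟨w, h1, h2, rfl⟩⟩

variable {C}

theorem Sees.unique {v : Fin C.size} {i : Fin n} {q q' : OnePoint ℝ} (h : C.Sees v i q)
    (h' : C.Sees v i q') : q = q' := by
  rcases h with ⟨h1, rfl⟩ | ⟨w, h1, h2, rfl⟩ <;> rcases h' with ⟨h1', rfl⟩ | ⟨w', h1', h2', rfl⟩
  · rfl
  · simp [h1] at h2'
  · simp [h1'] at h2
  · rw [eq_of_adj_of_dist_lt C.isTree h1 h1' h2 h2']

/-- Isomorphisms preserve what is seen from a bubble. -/
theorem Sees.of_isom {C' : StableCurve n} {e : C.tree ≃g C'.tree} {g : Fin C.size → GL (Fin 2) ℝ}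
    (h1 : ∀ i, C'.comp i = e (C.comp i)) (h2 : ∀ i, C'.mark i = g (C.comp i) • C.mark i)
    (h3 : ∀ v w, C.tree.Adj v w → C'.node (e v) (e w) = g v • C.node v w)
    {v : Fin C.size} {i : Fin n} {q : OnePoint ℝ} (h : C.Sees v i q) :
    C'.Sees (e v) i (g v • q) := by
  rcases h with ⟨rfl, rfl⟩ | ⟨w, h4, h5, rfl⟩
  · exact Or.inl ⟨h1 i, (h2 i).symm⟩
  · refine Or.inr ⟨e w, e.map_adj_iff.2 h4, ?_, (h3 v w h4).symm⟩
    rw [h1, Iso.dist_eq C.isTree.connected C'.isTree.connected,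
      Iso.dist_eq C.isTree.connected C'.isTree.connected]
    exact h5

/-- The point of the moduli space that a stable curve represents. -/
def toMbar (C : StableCurve n) : Mbar n := (⟦C⟧ : Quotient (StableCurve.setoid n))

/-- Isomorphisms transport positions by projective maps, which preserve cross-ratios; hence any
representative of the class may be used. -/
theorem toMbar_mem_crossRatioPreimage_iff {i j k l : Fin n} {U : Set (OnePoint ℝ)} :
    C.toMbar ∈ crossRatioPreimage i j k l U ↔
      ∃ v a b c d, C.Sees v i a ∧ C.Sees v j b ∧ C.Sees v k c ∧ C.Sees v l d ∧
        a ≠ b ∧ a ≠ c ∧ b ≠ c ∧ crossRatio a b c d ∈ U := by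
  constructor
  · rintro ⟨C', hC, v, a, b, c, d, ha, hb, hc, hd, g, ga, gb, gc, gd⟩
    obtain ⟨e, m, h1, h2, h3⟩ := Quotient.exact hC
    refine ⟨e v, m v • a, m v • b, m v • c, m v • d, ha.of_isom h1 h2 h3, hb.of_isom h1 h2 h3,
      hc.of_isom h1 h2 h3, hd.of_isom h1 h2 h3, ?_, ?_, ?_, ?_⟩
    · intro h
      rw [MulAction.injective _ h, gb] at ga
      simp at ga
    · intro h
      rw [MulAction.injective _ h, gc] at ga
      simp at ga
    · intro h
      rw [MulAction.injective _ h, gc] at gb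
      simp at gb
    · rwa [crossRatio_smul, ← smul_eq_crossRatio ga gb gc]
  · rintro ⟨v, a, b, c, d, ha, hb, hc, hd, hab, hac, hbc, hU⟩
    obtain ⟨g, ga, gb, gc⟩ := exists_smul_eq_zero_one_infty hab hac hbc
    exact ⟨C, rfl, v, a, b, c, d, ha, hb, hc, hd, g, ga, gb, gc,
      by rwa [smul_eq_crossRatio ga gb gc]⟩

/-- Beyond every double point there is a marked point. -/
theorem exists_label_beyond {v w : Fin C.size} (hvw : C.tree.Adj v w) :
    ∃ i, C.tree.dist w (C.comp i) < C.tree.dist v (C.comp i) := by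
  classical
  -- A bubble beyond the edge at maximal distance from `v` is a leaf, so stability puts marked
  -- points on it.
  obtain ⟨x, hx, hmax⟩ := Finset.exists_max_image
    (Finset.univ.filter fun x => C.tree.dist w x < C.tree.dist v x) (C.tree.dist v)
    ⟨w, by simp [SimpleGraph.dist_eq_one_iff_adj.2 hvw]⟩
  simp only [Finset.mem_filter, Finset.mem_univ, true_and] at hx hmax
  have hnb : (C.tree.neighborSet x).ncard ≤ 1 := by
    rw [Set.ncard_le_one]
    have key : ∀ y ∈ C.tree.neighborSet x, C.tree.dist y v < C.tree.dist x v := by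
      intro y hy
      have hxy : C.tree.Adj x y := hy
      rcases dist_lt_or_dist_lt_of_adj C.isTree hxy v with h | h
      · exfalso
        rcases dist_lt_or_dist_lt_of_adj C.isTree hvw y with h' | h'
        · obtain ⟨rfl, rfl⟩ := eq_of_adj_of_sides C.isTree hvw hxy.symm h' hx
          simp at h
        · have := hmax y h'
          rw [C.tree.dist_comm, C.tree.dist_comm (u := v)] at this
          omega
      · exact h
    exact fun y hy z hz => eq_of_adj_of_dist_lt C.isTree hy hz (key y hy) (key z hz)
  have hst := C.stable x
  have : {i | C.comp i = x}.Nonempty := by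
    refine Set.nonempty_of_ncard_ne_zero ?_
    omega
  obtain ⟨i, hi⟩ := this
  have hi : C.comp i = x := hi
  exact ⟨i, by rwa [hi]⟩

/-- Besides a double point, there are two more positions on a bubble at which marked points are
seen. -/
theorem exists_two_labels {v u : Fin C.size} (hvu : C.tree.Adj v u) :
    ∃ i j a b, C.Sees v i a ∧ C.Sees v j b ∧ a ≠ b ∧ a ≠ C.node v u ∧ b ≠ C.node v u := by
  -- `M` and `B` collect the special positions on `v` other than the double point towards `u`;
  -- stability leaves at least two.
  set M : Set (OnePoint ℝ) := C.mark '' {i | C.comp i = v} with hM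
  set B : Set (OnePoint ℝ) := C.node v '' (C.tree.neighborSet v \ {u}) with hB
  have hMc : M.ncard = {i | C.comp i = v}.ncard := by
    refine Set.InjOn.ncard_image fun i hi j hj h => ?_
    by_contra hij
    exact C.mark_ne_mark i j hij (Eq.trans hi (Eq.symm hj)) h
  have hBc : B.ncard + 1 = (C.tree.neighborSet v).ncard := by
    rw [hB, Set.InjOn.ncard_image, Set.ncard_sdiff_singleton_add_one (show u ∈ C.tree.neighborSet v from hvu)]
    intro w hw w' hw' h
    by_contra hne
    exact C.node_ne_node v w w' hw.1 hw'.1 hne h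
  have hd : Disjoint M B := by
    rw [Set.disjoint_left]
    rintro _ ⟨i, rfl, rfl⟩ ⟨w, hw, h⟩
    exact C.mark_ne_node i w hw.1 h.symm
  have hU : (M ∪ B).ncard = M.ncard + B.ncard := Set.ncard_union_eq hd
  have hst := C.stable v
  have hsee : ∀ a ∈ M ∪ B, (∃ i, C.Sees v i a) ∧ a ≠ C.node v u := by
    rintro _ (⟨i, rfl, rfl⟩ | ⟨w, ⟨hw, hwu⟩, rfl⟩)
    · exact ⟨⟨i, Or.inl ⟨rfl, rfl⟩⟩, C.mark_ne_node i u hvu⟩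
    · obtain ⟨i, hi⟩ := exists_label_beyond hw
      exact ⟨⟨i, Or.inr ⟨w, hw, hi, rfl⟩⟩, C.node_ne_node v w u hw hvu hwu⟩
  obtain ⟨a, b, ha, hb, hab⟩ := (Set.one_lt_ncard_iff).1 (show 1 < (M ∪ B).ncard by omega)
  obtain ⟨⟨i, hi⟩, hau⟩ := hsee a ha
  obtain ⟨⟨j, hj⟩, hbu⟩ := hsee b hb
  exact ⟨i, j, a, b, hi, hj, hab, hau, hbu⟩

/-- From a bubble on one side of a double point, all marked points beyond that double point are
seen at the same position, and at least two other positions are occupied. -/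
theorem exists_labels_of_side {S : Set (Fin n)} {v w x : Fin C.size} (hvw : C.tree.Adj v w)
    (h2 : ∀ i ∉ S, C.tree.dist w (C.comp i) < C.tree.dist v (C.comp i))
    (hx : C.tree.dist v x < C.tree.dist w x) :
    ∃ i ∈ S, ∃ j ∈ S, ∃ a b N, C.Sees x i a ∧ C.Sees x j b ∧ a ≠ b ∧ a ≠ N ∧ b ≠ N ∧
      ∀ o ∉ S, C.Sees x o N := by
  have hxw : x ≠ w := by rintro rfl; simp at hx
  -- The neighbour `u` in the direction of `w` is also the direction of every bubble beyond `w`.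
  obtain ⟨u, hu, hlt⟩ := exists_adj_dist_lt C.isTree hxw
  have hN : ∀ o ∉ S, C.Sees x o (C.node x u) := fun o ho =>
    Or.inr ⟨u, hu, dist_lt_of_sides C.isTree hvw hx hlt (h2 o ho), rfl⟩
  obtain ⟨i, j, a, b, ha, hb, hab, haN, hbN⟩ := exists_two_labels hu
  refine ⟨i, ?_, j, ?_, a, b, _, ha, hb, hab, haN, hbN, hN⟩
  · by_contra hi
    exact haN (ha.unique (hN i hi))
  · by_contra hj
    exact hbN (hb.unique (hN j hj))

/-- At the double point itself, no marked point on this side is seen. -/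
theorem Sees.ne_node {v w : Fin C.size} {i : Fin n} {q : OnePoint ℝ} (hvw : C.tree.Adj v w)
    (hi : C.tree.dist v (C.comp i) < C.tree.dist w (C.comp i)) (h : C.Sees v i q) :
    q ≠ C.node v w := by
  rcases h with ⟨rfl, rfl⟩ | ⟨u, h4, h5, rfl⟩
  · exact C.mark_ne_node i w hvw
  · refine C.node_ne_node v u w h4 hvw ?_
    rintro rfl
    omega

end StableCurve

end Mosaic

namespace Mosaic

open Filter Topology

/-! ### Curves with a single bubble. -/

section OneBubble

variable {n : ℕ}

/-- The stable curve with a single bubble and the given marked points. -/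
def oneBubble (hn : 3 ≤ n) (z : Fin n → OnePoint ℝ) (hz : Function.Injective z) :
    StableCurve n where
  size := 1
  tree := ⊥
  isTree := .of_subsingleton
  comp _ := 0
  mark := z
  node _ _ := OnePoint.infty
  mark_ne_mark _ _ hij _ := hz.ne hij
  node_ne_node _ _ _ h := absurd h (by simp)
  mark_ne_node _ _ h := absurd h (by simp)
  stable v := by
    have : {i : Fin n | (0 : Fin 1) = v} = Set.univ :=
      Set.eq_univ_of_forall fun i => Subsingleton.elim _ _
    rw [this]
    simp only [Set.ncard_univ, Nat.card_eq_fintype_card, Fintype.card_fin]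
    omega

theorem oneBubble_sees_iff {hn : 3 ≤ n} {z : Fin n → OnePoint ℝ} {hz : Function.Injective z}
    {v : Fin (oneBubble hn z hz).size} {i : Fin n} {q : OnePoint ℝ} :
    (oneBubble hn z hz).Sees v i q ↔ q = z i := by
  constructor
  · rintro (⟨-, h⟩ | ⟨w, h, -⟩)
    · exact h
    · exact ((SimpleGraph.bot_adj (V := Fin 1) _ _).1 h).elim
  · exact fun h => Or.inl ⟨@Subsingleton.elim (Fin 1) _ _ _, h⟩

/-- The point of the moduli space given by distinct marked points on a single bubble. -/
def mkOneBubble (hn : 3 ≤ n) (z : Fin n → OnePoint ℝ) (hz : Function.Injective z) : Mbar n :=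
  (oneBubble hn z hz).toMbar

theorem mkOneBubble_mem_crossRatioPreimage_iff {hn : 3 ≤ n} {z : Fin n → OnePoint ℝ}
    {hz : Function.Injective z} {i j k l : Fin n} (hij : i ≠ j) (hik : i ≠ k) (hjk : j ≠ k)
    {U : Set (OnePoint ℝ)} :
    mkOneBubble hn z hz ∈ crossRatioPreimage i j k l U ↔
      crossRatio (z i) (z j) (z k) (z l) ∈ U := by
  refine StableCurve.toMbar_mem_crossRatioPreimage_iff.trans ?_
  simp only [oneBubble_sees_iff]
  constructor
  · rintro ⟨v, a, b, c, d, rfl, rfl, rfl, rfl, -, -, -, h⟩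
    exact h
  · exact fun h => ⟨(0 : Fin 1), _, _, _, _, rfl, rfl, rfl, rfl, hz.ne hij, hz.ne hik, hz.ne hjk, h⟩

theorem mkOneBubble_mem_openCell (hn : 3 ≤ n) {z : Fin n → OnePoint ℝ}
    (hz : Function.Injective z) {σ : Fin n ≃ Fin n}
    (h : ∃ g : GL (Fin 2) ℝ, IsStandard fun s => g • z (σ s)) :
    mkOneBubble hn z hz ∈ openCell σ :=
  ⟨oneBubble hn z hz, rfl, rfl, h⟩

/-- The projective transformation in `openCell` is absorbed into the marked points. -/
theorem exists_eq_mkOneBubble (hn : 3 ≤ n) {σ : Fin n ≃ Fin n} {x : Mbar n}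
    (hx : x ∈ openCell σ) :
    ∃ (z : Fin n → OnePoint ℝ) (hz : Function.Injective z), x = mkOneBubble hn z hz ∧
      IsStandard fun s => z (σ s) := by
  obtain ⟨C, rfl, hC, g, hg⟩ := hx
  obtain ⟨m, G, hG, comp, mark, node, h1, h2, h3, h4⟩ := C
  dsimp only at hC
  subst hC
  have hz : Function.Injective fun i => g • mark i := by
    intro i j hij
    by_contra hne
    exact h1 i j hne (Subsingleton.elim _ _) (MulAction.injective g hij)
  have hbot : G = ⊥ := Subsingleton.elim _ _
  subst hbot
  refine ⟨_, hz, ?_, hg⟩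
  refine Quotient.sound ⟨SimpleGraph.Iso.refl, fun _ => g, fun i => ?_, fun i => rfl,
    fun v w h => absurd h (by simp)⟩
  exact @Subsingleton.elim (Fin 1) _ _ _

end OneBubble

/-! ### Convergence of configurations to a stable curve. -/

section Convergence

variable {n : ℕ} {Y : Type*} {F : Filter Y} {C : StableCurve n}

/-- The cross-ratios of the configurations `z y` converge along `F` to those of the stable
curve `C`. -/
def CrossRatiosTendsto (F : Filter Y) (z : Y → Fin n → OnePoint ℝ) (C : StableCurve n) : Prop :=
  ∀ v i j k l a b c d, C.Sees v i a → C.Sees v j b → C.Sees v k c → C.Sees v l d →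
    a ≠ b → a ≠ c → b ≠ c →
    Tendsto (fun y => crossRatio (z y i) (z y j) (z y k) (z y l)) F (𝓝 (crossRatio a b c d))

theorem CrossRatiosTendsto.smul {z : Y → Fin n → OnePoint ℝ} (h : CrossRatiosTendsto F z C)
    (g : Y → GL (Fin 2) ℝ) : CrossRatiosTendsto F (fun y i => g y • z y i) C := by
  unfold CrossRatiosTendsto
  simp_rw [crossRatio_smul]
  exact h

theorem CrossRatiosTendsto.of_tendsto {hn : 3 ≤ n} {z : Y → Fin n → OnePoint ℝ}
    {hz : ∀ y, Function.Injective (z y)}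
    (h : Tendsto (fun y => mkOneBubble hn (z y) (hz y)) F
      (𝓝 C.toMbar)) :
    CrossRatiosTendsto F z C := by
  intro v i j k l a b c d ha hb hc hd hab hac hbc
  have hij : i ≠ j := by rintro rfl; exact hab (ha.unique hb)
  have hik : i ≠ k := by rintro rfl; exact hac (ha.unique hc)
  have hjk : j ≠ k := by rintro rfl; exact hbc (hb.unique hc)
  rw [tendsto_nhds]
  intro U hU hmem
  have hopen : IsOpen (crossRatioPreimage i j k l U : Set (Mbar n)) :=
    TopologicalSpace.isOpen_generateFrom_of_mem ⟨i, j, k, l, U, hij, hik, hjk, hU, rfl⟩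
  have := h.eventually (hopen.mem_nhds (StableCurve.toMbar_mem_crossRatioPreimage_iff.2
    ⟨v, a, b, c, d, ha, hb, hc, hd, hab, hac, hbc, hmem⟩))
  filter_upwards [this] with y hy
  exact (mkOneBubble_mem_crossRatioPreimage_iff hij hik hjk).1 hy

/-- Configurations converge to a stable curve if, for each of its bubbles, they converge after
suitable projective transformations to what is seen from this bubble. -/
theorem tendsto_mkOneBubble {hn : 3 ≤ n} {z : Y → Fin n → OnePoint ℝ}
    {hz : ∀ y, Function.Injective (z y)}
    (h : ∀ v, ∃ (g : Y → GL (Fin 2) ℝ) (γ : GL (Fin 2) ℝ), ∀ l q, C.Sees v l q →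
      Tendsto (fun y => g y • z y l) F (𝓝 (γ • q))) :
    Tendsto (fun y => mkOneBubble hn (z y) (hz y)) F
      (𝓝 C.toMbar) := by
  rw [TopologicalSpace.tendsto_nhds_generateFrom_iff]
  rintro _ ⟨i, j, k, l, U, hij, hik, hjk, hU, rfl⟩ hmem
  obtain ⟨v, a, b, c, d, ha, hb, hc, hd, hab, hac, hbc, hmem⟩ :=
    StableCurve.toMbar_mem_crossRatioPreimage_iff.1 hmem
  obtain ⟨g, γ, hg⟩ := h v
  have hinj := MulAction.injective (β := OnePoint ℝ) γ
  have := tendsto_crossRatio (hg i a ha) (hg j b hb) (hg k c hc) (hg l d hd)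
    (hinj.ne hab) (hinj.ne hac) (hinj.ne hbc)
  simp_rw [crossRatio_smul] at this
  filter_upwards [this.eventually (hU.mem_nhds hmem)] with y hy
  exact (mkOneBubble_mem_crossRatioPreimage_iff hij hik hjk).2 hy

/-- The projective transformation `t ↦ -t`. -/
noncomputable def negGL : GL (Fin 2) ℝ :=
  Matrix.GeneralLinearGroup.mkOfDetNeZero !![-1, 0; 0, 1] (by simp)

/-- The projective transformation `t ↦ 1 / t`. -/
noncomputable def invGL : GL (Fin 2) ℝ :=
  Matrix.GeneralLinearGroup.mkOfDetNeZero !![0, 1; 1, 0] (by simp)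

theorem negGL_smul_homog {a b : ℝ} (h : a ≠ 0 ∨ b ≠ 0) :
    negGL • homog a b = homog (-a) b := by
  rw [smul_homog _ h]
  simp [negGL, Matrix.GeneralLinearGroup.mkOfDetNeZero]

theorem invGL_smul_homog {a b : ℝ} (h : a ≠ 0 ∨ b ≠ 0) : invGL • homog a b = homog b a := by
  rw [smul_homog _ h]
  simp [invGL, Matrix.GeneralLinearGroup.mkOfDetNeZero]

/-- Let the marked points with labels in `S` be at `r`, the others at `1 / r`, where products
of the two kinds of `r` tend to zero.  Seen from a bubble on which all labels outside `S` are at the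
same position, the limit does not change if one applies `t ↦ -t` to the points of `S`. -/
theorem exists_smul_tendsto_of_negate {S : Set (Fin n)} {z z' : Y → Fin n → OnePoint ℝ}
    {r : Y → Fin n → ℝ} (hz : ∀ y, Function.Injective (z y))
    (hzS : ∀ y, ∀ l ∈ S, z y l = homog (r y l) 1) (hzO : ∀ y, ∀ l ∉ S, z y l = homog 1 (r y l))
    (hzS' : ∀ y, ∀ l ∈ S, z' y l = homog (-r y l) 1)
    (hzO' : ∀ y, ∀ l ∉ S, z' y l = homog 1 (r y l))
    (hr : ∀ s ∈ S, ∀ o ∉ S, Tendsto (fun y => r y s * r y o) F (𝓝 0))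
    (hC : CrossRatiosTendsto F z C) {e : Fin n} (he : e ∉ S) (hre : ∀ y, r y e = 0)
    {v : Fin C.size} {i j : Fin n} (hi : i ∈ S) (hj : j ∈ S) {a b N : OnePoint ℝ}
    (ha : C.Sees v i a) (hb : C.Sees v j b) (hab : a ≠ b) (haN : a ≠ N) (hbN : b ≠ N)
    (hN : ∀ o ∉ S, C.Sees v o N) :
    ∃ (g : Y → GL (Fin 2) ℝ) (γ : GL (Fin 2) ℝ), ∀ l q, C.Sees v l q →
      Tendsto (fun y => g y • z' y l) F (𝓝 (γ • q)) := by
  have hij : i ≠ j := by rintro rfl; exact hab (ha.unique hb)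
  have hie : i ≠ e := by rintro rfl; exact he hi
  have hje : j ≠ e := by rintro rfl; exact he hj
  choose g g0 g1 g2 using fun y => exists_smul_eq_zero_one_infty
    ((hz y).ne hij) ((hz y).ne hie) ((hz y).ne hje)
  obtain ⟨γ, γ0, γ1, γ2⟩ := exists_smul_eq_zero_one_infty hab haN hbN
  -- The extra `negGL` moves the points of `S` back to their places in `z y`, so only labels outside
  -- `S` need a new argument.
  refine ⟨fun y => g y * negGL, γ, fun l q hq => ?_⟩
  by_cases hl : l ∈ S
  · have := hC v i j e l a b N q ha hb (hN e he) hq hab haN hbN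
    rw [← smul_eq_crossRatio γ0 γ1 γ2] at this
    refine this.congr fun y => ?_
    rw [hzS' y l hl, mul_smul, negGL_smul_homog (by simp), neg_neg, ← hzS y l hl,
      smul_eq_crossRatio (g0 y) (g1 y) (g2 y)]
  · obtain rfl := (hN l hl).unique hq
    -- Here `i`, `j`, `e` are normalized to `0`, `1`, `∞` and `l` sits at `-1 / r y l`; since both
    -- products vanish in the limit, it tends to `∞ = γ • N`.
    have h1 : ∀ y, (g y * negGL) • z' y l =
        homog (1 + r y i * r y l) (r y i * r y l - r y j * r y l) := by
      intro y
      rw [mul_smul, hzO' y l hl, negGL_smul_homog (by simp),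
        smul_eq_crossRatio (g0 y) (g1 y) (g2 y), hzS y i hi, hzS y j hj, hzO y e he, hre y,
        crossRatio_homog (by simp) (by simp) (by simp) (by simp)]
      congr 1 <;> ring
    simp_rw [h1]
    have := tendsto_homog ((hr i hi l hl).const_add 1) ((hr i hi l hl).sub (hr j hj l hl))
      (by simp)
    rwa [sub_zero, homog_zero_right, ← γ2] at this

/-- If the labels in `S` are separated from the others by a double point of the limit curve, then
the limit does not change if one applies `t ↦ -t` to the points of `S`, in suitable
coordinates. -/
theorem exists_smul_tendsto_of_hasNode {S : Set (Fin n)} {v w : Fin C.size}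
    (hvw : C.tree.Adj v w) (hS : ∀ i ∈ S, C.tree.dist v (C.comp i) < C.tree.dist w (C.comp i))
    (hO : ∀ i ∉ S, C.tree.dist w (C.comp i) < C.tree.dist v (C.comp i))
    {z z' : Y → Fin n → OnePoint ℝ}
    {r : Y → Fin n → ℝ} (hz : ∀ y, Function.Injective (z y))
    (hzS : ∀ y, ∀ l ∈ S, z y l = homog (r y l) 1) (hzO : ∀ y, ∀ l ∉ S, z y l = homog 1 (r y l))
    (hzS' : ∀ y, ∀ l ∈ S, z' y l = homog (-r y l) 1)
    (hzO' : ∀ y, ∀ l ∉ S, z' y l = homog 1 (r y l))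
    (hr : ∀ s ∈ S, ∀ o ∉ S, Tendsto (fun y => r y s * r y o) F (𝓝 0))
    (hC : CrossRatiosTendsto F z C) {e f : Fin n} (he : e ∉ S) (hre : ∀ y, r y e = 0)
    (hf : f ∈ S) (hrf : ∀ y, r y f = 0) (x : Fin C.size) :
    ∃ (g : Y → GL (Fin 2) ℝ) (γ : GL (Fin 2) ℝ), ∀ l q, C.Sees x l q →
      Tendsto (fun y => g y • z' y l) F (𝓝 (γ • q)) := by
  rcases dist_lt_or_dist_lt_of_adj C.isTree hvw x with hx | hx
  · obtain ⟨i, hi, j, hj, a, b, N, ha, hb, hab, haN, hbN, hN⟩ :=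
      StableCurve.exists_labels_of_side hvw hO hx
    exact exists_smul_tendsto_of_negate hz hzS hzO hzS' hzO' hr hC he hre hi hj ha hb hab haN hbN
      hN
  · obtain ⟨i, hi, j, hj, a, b, N, ha, hb, hab, haN, hbN, hN⟩ :=
      StableCurve.exists_labels_of_side (S := Sᶜ) hvw.symm (fun i hi => hS i (not_not.1 hi)) hx
    -- Inversion exchanges the roles of `S` and `Sᶜ`. Up to a global sign, negating the points of
    -- `S` is the same as negating those of `Sᶜ`.
    obtain ⟨g, γ, hg⟩ := exists_smul_tendsto_of_negate (S := Sᶜ)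
      (z := fun y l => invGL • z y l) (z' := fun y l => negGL • invGL • z' y l) (r := r)
      (fun y => (MulAction.injective invGL).comp (hz y))
      (fun y l hl => by rw [hzO y l hl, invGL_smul_homog (by simp)])
      (fun y l hl => by rw [hzS y l (not_not.1 hl), invGL_smul_homog (by simp)])
      (fun y l hl => by rw [hzO' y l hl, invGL_smul_homog (by simp), negGL_smul_homog (by simp)])
      (fun y l hl => by
        rw [hzS' y l (not_not.1 hl), invGL_smul_homog (by simp), negGL_smul_homog (by simp),
          ← homog_mul (c := -1) (by simp)]
        simp)
      (fun s hs o ho => by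
        simpa only [mul_comm] using hr o (not_not.1 ho) s hs)
      (hC.smul fun _ => invGL) (e := f) (not_not.2 hf) hrf hi hj ha hb hab haN hbN hN
    refine ⟨fun y => g y * negGL * invGL, γ, fun l q hq => ?_⟩
    simpa only [mul_smul] using hg l q hq

/-- If a double point of the limit curve separates the labels in `S` from the others, then the
ratios of the distances from a point of `S` to the points of `S` and to the others tend to zero. -/
theorem tendsto_mul_of_hasNode {S : Set (Fin n)} {v w : Fin C.size}
    (hvw : C.tree.Adj v w) (hS : ∀ i ∈ S, C.tree.dist v (C.comp i) < C.tree.dist w (C.comp i))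
    {z : Y → Fin n → OnePoint ℝ}
    {r : Y → Fin n → ℝ} (hz : ∀ y, Function.Injective (z y))
    (hzS : ∀ y, ∀ l ∈ S, z y l = homog (r y l) 1) (hzO : ∀ y, ∀ l ∉ S, z y l = homog 1 (r y l))
    (hC : CrossRatiosTendsto F z C) {e i j : Fin n} (he : e ∉ S) (hre : ∀ y, r y e = 0)
    (hi : i ∈ S) (hri : ∀ y, r y i = 0) (hj : j ∈ S) {a b : OnePoint ℝ}
    (ha : C.Sees v i a) (hb : C.Sees v j b) (hab : a ≠ b)
    (hN : ∀ o ∉ S, C.Sees v o (C.node v w)) {s o : Fin n} (hs : s ∈ S) (ho : o ∉ S) :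
    Tendsto (fun y => r y s * r y o) F (𝓝 0) := by
  have haN := ha.ne_node hvw (hS i hi)
  have hbN := hb.ne_node hvw (hS j hj)
  obtain ⟨q, hq⟩ := C.exists_sees v s
  have hqN := hq.ne_node hvw (hS s hs)
  have hij : i ≠ j := by rintro rfl; exact hab (ha.unique hb)
  have hrj : ∀ y, r y j ≠ 0 := by
    intro y h
    refine (hz y).ne hij ?_
    rw [hzS y i hi, hzS y j hj, hri, h]
  obtain ⟨γ, γ0, γ1, γ2⟩ := exists_smul_eq_zero_one_infty hab haN hbN
  -- With `i` at `0` and `e` at `∞`, these cross-ratios are `r s / r j` and `1 / (r o * r j)`. The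
  -- first has a finite limit, since `s` is not seen at the double point; the second tends to `∞`.
  -- Their quotient is `r s * r o`.
  have t1 := hC v i j e s a b _ q ha hb (hN e he) hq hab haN hbN
  have t2 := hC v i j e o a b _ _ ha hb (hN e he) (hN o ho) hab haN hbN
  rw [← smul_eq_crossRatio γ0 γ1 γ2] at t1 t2
  rw [γ2] at t2
  have hγq : γ • q ≠ OnePoint.infty := by
    rw [← γ2]
    exact (MulAction.injective γ).ne hqN
  have e1 : ∀ y, crossRatio (z y i) (z y j) (z y e) (z y s) = homog (r y s) (r y j) := by
    intro y
    rw [hzS y i hi, hzS y j hj, hzO y e he, hzS y s hs, hre, hri,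
      crossRatio_homog (by simp) (by simp) (by simp) (by simp),
      ← homog_mul (c := -1) (by simp) (r y s)]
    congr 1 <;> ring
  have e2 : ∀ y, crossRatio (z y i) (z y j) (z y e) (z y o) = homog 1 (r y o * r y j) := by
    intro y
    rw [hzS y i hi, hzS y j hj, hzO y e he, hzO y o ho, hre, hri,
      crossRatio_homog (by simp) (by simp) (by simp) (by simp),
      ← homog_mul (c := -1) (by simp) 1]
    congr 1 <;> ring
  simp_rw [e1] at t1
  simp_rw [e2] at t2
  obtain ⟨A, B, a₀, b₀, h1, h2, h3, h4, h5, h6⟩ := exists_homog_of_tendsto t1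
  obtain ⟨A', B', a₀', b₀', h1', h2', h3', h4', h5', h6'⟩ := exists_homog_of_tendsto t2
  have hb0 : b₀ ≠ 0 := by
    rintro rfl
    exact hγq (by rw [h6, homog_zero_right])
  have hb0' : b₀' = 0 := by
    by_contra h
    simp [homog, h] at h6'
  have ha0' : a₀' ≠ 0 := by simpa [hb0'] using h5'
  have hlim := (h3.div h4 hb0).mul (h4'.div h3' ha0')
  rw [hb0', zero_div, mul_zero] at hlim
  refine hlim.congr' ?_
  filter_upwards [h4.eventually_ne hb0, h3'.eventually_ne ha0'] with y hy hy'
  have k1 := (homog_eq_homog_iff (Or.inr (hrj y)) (h1 y)).1 (h2 y)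
  have k2 := (homog_eq_homog_iff (by simp) (h1' y)).1 (h2' y)
  have hj0 := hrj y
  simp only [Pi.div_apply]
  rw [div_mul_div_comm, div_eq_iff (mul_ne_zero hy hy')]
  apply mul_left_cancel₀ hj0
  linear_combination (-r y j * r y o * A' y) * k1 + A y * r y j * k2

end Convergence

end Mosaic

namespace Mosaic

open Filter Topology

/-! ### Reversing a block of marked points in an associahedron. -/

variable {n : ℕ}

/-- Only the order matters: an affine map sends the first value to `0` and the last finite one to
`1`, and fixes `∞`. -/
theorem exists_isStandard_of_increasing (hn : 3 ≤ n) {p : Fin n → OnePoint ℝ} {u : Fin n → ℝ}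
    (hu : ∀ s s' : Fin n, s < s' → s'.val + 1 < n → u s < u s')
    (hp : ∀ s : Fin n, p s = if s.val + 1 = n then OnePoint.infty else (u s : OnePoint ℝ)) :
    ∃ g : GL (Fin 2) ℝ, IsStandard fun s => g • p s := by
  set α := u ⟨0, by omega⟩ with hα
  set β := u ⟨n - 2, by omega⟩ with hβ
  have hpos : 0 < β - α := by
    have := hu ⟨0, by omega⟩ ⟨n - 2, by omega⟩ (by simp only [Fin.lt_def]; omega)
      (by simp only; omega)
    linarith
  refine ⟨Matrix.GeneralLinearGroup.mkOfDetNeZero !![1, -α; 0, β - α] (by simp [hpos.ne']),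
    fun s => (u s - α) / (β - α), fun s hs => ?_, fun s hs => ?_, fun s s' h h' => ?_,
    fun s => ?_⟩
  · have : s = ⟨0, by omega⟩ := Fin.ext hs
    simp [this, hα]
  · have : s = ⟨n - 2, by omega⟩ := Fin.ext (by simp only; omega)
    simp only [this]
    exact div_self hpos.ne'
  · have := hu s s' h h'
    dsimp only
    gcongr
  · dsimp only
    rw [hp]
    split_ifs with h
    · rw [← homog_zero_right 1, smul_homog _ (by simp)]
      simp [Matrix.GeneralLinearGroup.mkOfDetNeZero, homog]
    · rw [← homog_one_right, ← homog_one_right, smul_homog _ (by simp)]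
      have : β + -α ≠ 0 := by linarith
      simp [Matrix.GeneralLinearGroup.mkOfDetNeZero, homog, this, sub_eq_add_neg]

theorem injective_of_isStandard {σ : Fin n ≃ Fin n} {z : Fin n → OnePoint ℝ} {g : GL (Fin 2) ℝ}
    (h : IsStandard fun s => g • z (σ s)) : Function.Injective z := by
  obtain ⟨t, -, -, h2, h3⟩ := h
  beta_reduce at h3
  have key : ∀ s s' : Fin n, s < s' → z (σ s) ≠ z (σ s') := by
    intro s s' hss he
    have := h3 s
    rw [he, h3 s', if_neg (show ¬ s.val + 1 = n by simp only [Fin.lt_def] at hss; omega)] at this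
    split_ifs at this with h4
    · exact OnePoint.infty_ne_coe _ this
    · exact (h2 s s' hss (by omega)).ne' (OnePoint.coe_eq_coe.1 this)
  intro i j hij
  obtain ⟨s, rfl⟩ := σ.surjective i
  obtain ⟨s', rfl⟩ := σ.surjective j
  rcases lt_trichotomy s s' with h | h | h
  · exact absurd hij (key _ _ h)
  · rw [h]
  · exact absurd hij.symm (key _ _ h)

open Classical in
/-- The points with labels in `S` at `r`, the other ones at `1 / r`. -/
noncomputable def splitPoints (S : Set (Fin n)) (r : Fin n → ℝ) (l : Fin n) : OnePoint ℝ :=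
  if l ∈ S then homog (r l) 1 else homog 1 (r l)

open Classical in
/-- The points with labels in `S` at `-r`, the other ones at `1 / r`. -/
noncomputable def negateSplitPoints (S : Set (Fin n)) (r : Fin n → ℝ) (l : Fin n) : OnePoint ℝ :=
  if l ∈ S then homog (-r l) 1 else homog 1 (r l)

open Classical in
/-- The coordinates for `splitPoints` of the points `t` on the sides of the polygon, with the last
one at `∞`, after translating the point with label `f` to zero. -/
noncomputable def splitCoords (σ : Fin n ≃ Fin n) (S : Set (Fin n)) (f : Fin n) (t : Fin n → ℝ)
    (l : Fin n) : ℝ :=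
  if l ∈ S then t (σ.symm l) - t (σ.symm f)
  else if (σ.symm l).val + 1 = n then 0 else (t (σ.symm l) - t (σ.symm f))⁻¹

/-- The translation `t ↦ t - c`. -/
noncomputable def translateGL (c : ℝ) : GL (Fin 2) ℝ :=
  Matrix.GeneralLinearGroup.mkOfDetNeZero !![1, -c; 0, 1] (by simp)

theorem cutLabels_apply_iff {σ : Fin n ≃ Fin n} {d : Fin n × Fin n} {s : Fin n} :
    σ s ∈ Polygon.cutLabels σ d ↔ d.1.val ≤ s.val ∧ s.val < d.2.val := by
  simp only [Polygon.cutLabels, Set.mem_ofPred_eq, Equiv.symm_apply_apply, Fin.le_def, Fin.lt_def]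

/-- The last side lies outside the piece, because `d.2 ≤ n - 1`; its position `∞` is recorded as `r
= 0`. Other points outside the piece differ from that of `f`, so the reciprocals are genuine. -/
theorem translateGL_smul_eq_splitPoints {σ : Fin n ≃ Fin n} {d : Fin n × Fin n} {f : Fin n}
    (hf : f ∈ Polygon.cutLabels σ d) {z : Fin n → OnePoint ℝ} {t : Fin n → ℝ}
    (h2 : ∀ s s' : Fin n, s < s' → s'.val + 1 < n → t s < t s')
    (h3 : ∀ s : Fin n, z (σ s) = if s.val + 1 = n then OnePoint.infty else (t s : OnePoint ℝ))
    (l : Fin n) :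
    translateGL (t (σ.symm f)) • z l =
      splitPoints (Polygon.cutLabels σ d) (splitCoords σ (Polygon.cutLabels σ d) f t) l := by
  obtain ⟨s, rfl⟩ := σ.surjective l
  obtain ⟨a, rfl⟩ := σ.surjective f
  have ha := cutLabels_apply_iff.1 hf
  have hd := d.2.isLt
  have hinf : translateGL (t a) • (OnePoint.infty : OnePoint ℝ) = OnePoint.infty := by
    rw [← homog_zero_right 1, smul_homog _ (by simp)]
    simp [translateGL, Matrix.GeneralLinearGroup.mkOfDetNeZero]
  have hcoe : ∀ c : ℝ, translateGL (t a) • (c : OnePoint ℝ) = homog (c - t a) 1 := by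
    intro c
    rw [← homog_one_right, smul_homog _ (by simp)]
    simp [translateGL, Matrix.GeneralLinearGroup.mkOfDetNeZero, sub_eq_add_neg]
  rw [h3, Equiv.symm_apply_apply]
  unfold splitPoints splitCoords
  by_cases hs : σ s ∈ Polygon.cutLabels σ d
  · have hs' := cutLabels_apply_iff.1 hs
    rw [if_pos hs, if_pos hs, if_neg (by omega), Equiv.symm_apply_apply, Equiv.symm_apply_apply,
      hcoe]
  · rw [if_neg hs, if_neg hs, Equiv.symm_apply_apply, Equiv.symm_apply_apply]
    have hs' := mt cutLabels_apply_iff.2 hs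
    split_ifs with h
    · rw [hinf, homog_zero_right]
    · rw [hcoe]
      have hne : t s - t a ≠ 0 := by
        rw [sub_ne_zero]
        rcases lt_trichotomy s a with h' | h' | h'
        · exact (h2 s a h' (by omega)).ne
        · exact absurd (h' ▸ ha) hs'
        · exact (h2 a s h' (by omega)).ne'
      rw [← homog_mul hne 1, mul_one, mul_inv_cancel₀ hne]

/-- If the points of the piece that is cut off by `d` are closer together than to the other points,
then applying `t ↦ -t` to them gives a configuration in the twisted cell. -/
theorem exists_isStandard_negateSplitPoints (hn : 3 ≤ n) {σ : Fin n ≃ Fin n} {d : Fin n × Fin n}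
    {f : Fin n} (hf : f ∈ Polygon.cutLabels σ d) {t : Fin n → ℝ}
    (h2 : ∀ s s' : Fin n, s < s' → s'.val + 1 < n → t s < t s')
    (hr : ∀ s ∈ Polygon.cutLabels σ d, ∀ o ∉ Polygon.cutLabels σ d,
      |splitCoords σ (Polygon.cutLabels σ d) f t s *
        splitCoords σ (Polygon.cutLabels σ d) f t o| < 1) :
    ∃ g : GL (Fin 2) ℝ, IsStandard fun s => g •
      negateSplitPoints (Polygon.cutLabels σ d) (splitCoords σ (Polygon.cutLabels σ d) f t)
        (((flipSide d.1 d.2).symm.trans σ) s) := by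
  obtain ⟨a, rfl⟩ := σ.surjective f
  have ha := cutLabels_apply_iff.1 hf
  have hd := d.2.isLt
  -- The bound on the products says that points of the piece are closer to the origin `t a` than all
  -- other points.
  have hr' : ∀ s : Fin n, d.1.val ≤ s.val → s.val < d.2.val → ∀ o : Fin n,
      ¬ (d.1.val ≤ o.val ∧ o.val < d.2.val) → o.val + 1 < n → |t s - t a| < |t o - t a| := by
    intro s hs1 hs2 o ho hon
    have hsS : σ s ∈ Polygon.cutLabels σ d := cutLabels_apply_iff.2 ⟨hs1, hs2⟩
    have hoS : σ o ∉ Polygon.cutLabels σ d := mt cutLabels_apply_iff.1 ho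
    have := hr _ hsS _ hoS
    rw [splitCoords, splitCoords, if_pos hsS, if_neg hoS] at this
    simp only [Equiv.symm_apply_apply] at this
    rw [if_neg (by omega), abs_mul, abs_inv, ← div_eq_mul_inv] at this
    have hne : t o - t a ≠ 0 := by
      rw [sub_ne_zero]
      rcases lt_trichotomy o a with h' | h' | h'
      · exact (h2 o a h' (by omega)).ne
      · exact absurd (h' ▸ ha) ho
      · exact (h2 a o h' (by omega)).ne'
    rwa [div_lt_one (abs_pos.2 hne)] at this
  -- On the piece, the reversal of the sides and the sign cancel, so the values increase again.
  refine exists_isStandard_of_increasing hn (u := fun s =>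
    if d.1.val ≤ s.val ∧ s.val < d.2.val then -(t ((flipSide d.1 d.2).symm s) - t a)
    else t s - t a) (fun s s' hs hs' => ?_) (fun s => ?_)
  · simp only [Fin.lt_def] at hs
    have f1 : ∀ s : Fin n, d.1.val ≤ s.val ∧ s.val < d.2.val →
        ((flipSide d.1 d.2).symm s).val = d.1.val + d.2.val - 1 - s.val := fun s h => if_pos h
    split_ifs with c1 c2 c2
    · have := h2 ((flipSide d.1 d.2).symm s') ((flipSide d.1 d.2).symm s)
        (by simp only [Fin.lt_def]; rw [f1 s c1, f1 s' c2]; omega) (by rw [f1 s c1]; omega)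
      linarith
    -- For one side in the piece and one outside, the order survives negation because the outer
    -- point has the larger absolute value.
    · have e1 := f1 s c1
      have k1 := hr' ((flipSide d.1 d.2).symm s) (by omega) (by omega) s' c2 hs'
      have k2 := h2 a s' (by simp only [Fin.lt_def]; omega) hs'
      rw [abs_of_pos (sub_pos.2 k2), abs_lt] at k1
      linarith [k1.1]
    · have e1 := f1 s' c2
      have k1 := hr' ((flipSide d.1 d.2).symm s') (by omega) (by omega) s c1 (by omega)
      have k2 := h2 s a (by simp only [Fin.lt_def]; omega) (by omega)
      rw [abs_of_neg (sub_neg.2 k2), abs_lt] at k1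
      linarith [k1.2]
    · linarith [h2 s s' (by simpa only [Fin.lt_def] using hs) hs']
  · rw [Equiv.trans_apply, negateSplitPoints, splitCoords, Equiv.symm_apply_apply,
      Equiv.symm_apply_apply]
    by_cases hs : d.1.val ≤ s.val ∧ s.val < d.2.val
    · have e : ((flipSide d.1 d.2).symm s).val = d.1.val + d.2.val - 1 - s.val := if_pos hs
      have hS : σ ((flipSide d.1 d.2).symm s) ∈ Polygon.cutLabels σ d :=
        cutLabels_apply_iff.2 ⟨by omega, by omega⟩
      rw [if_pos hS, if_pos hS, if_neg (by omega), if_pos hs, homog_one_right]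
    · have e : (flipSide d.1 d.2).symm s = s := Fin.ext (if_neg hs)
      rw [e]
      have hS : σ s ∉ Polygon.cutLabels σ d := mt cutLabels_apply_iff.1 hs
      rw [if_neg hS, if_neg hS, if_neg hs]
      split_ifs with h
      · exact homog_zero_right _
      · have hne : t s - t a ≠ 0 := by
          have := hr' a ha.1 ha.2 s hs (by omega)
          rw [sub_self, abs_zero] at this
          exact abs_pos.1 this
        rw [← homog_mul hne, mul_one, mul_inv_cancel₀ hne, homog_one_right]

/-- A curve in an associahedron with a double point that cuts off a piece of the polygon lies in
the associahedron of the twisted labeling, too. -/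
theorem mem_associahedron_flip (hn : 3 ≤ n) {σ : Fin n ≃ Fin n} {d : Fin n × Fin n}
    {C : StableCurve n} (hx : C.toMbar ∈ associahedron σ)
    (hnode : C.HasNode (Polygon.cutLabels σ d)) :
    C.toMbar ∈ associahedron ((flipSide d.1 d.2).symm.trans σ) := by
  set S := Polygon.cutLabels σ d with hS
  obtain ⟨v, w, hvw, hSv, hOw⟩ := hnode
  have hlast : n - 1 < n := by omega
  set e : Fin n := σ ⟨n - 1, hlast⟩ with hedef
  have he : e ∉ S := fun h => by
    have := (cutLabels_apply_iff.1 h).2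
    have := d.2.isLt
    simp only at *
    omega
  have hN : ∀ o ∉ S, C.Sees v o (C.node v w) := fun o ho => Or.inr ⟨w, hvw, hOw o ho, rfl⟩
  -- The label `f` becomes the origin and `j` fixes the scale on the bubble `v`. Both are in `S`,
  -- since all other labels are seen at the double point.
  obtain ⟨f, j, a, b, ha, hb, hab, haN, hbN⟩ := StableCurve.exists_two_labels hvw
  have hf : f ∈ S := by
    by_contra h
    exact haN (ha.unique (hN f h))
  have hj : j ∈ S := by
    by_contra h
    exact hbN (hb.unique (hN j h))
  have hF : (comap ((↑) : openCell σ → Mbar n) (𝓝 C.toMbar)).NeBot :=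
    mem_closure_iff_comap_neBot.1 hx
  set F := comap ((↑) : openCell σ → Mbar n) (𝓝 C.toMbar) with hFdef
  choose z hz hzx hst using fun y : openCell σ => exists_eq_mkOneBubble hn y.2
  choose t h0 h1 h2 h3 using hst
  have hC : CrossRatiosTendsto F z C := by
    refine CrossRatiosTendsto.of_tendsto (hn := hn) (hz := hz) ?_
    simp_rw [← hzx]
    exact tendsto_comap
  set r : openCell σ → Fin n → ℝ := fun y => splitCoords σ S f (t y) with hrdef
  have hZ : ∀ y l, translateGL (t y (σ.symm f)) • z y l = splitPoints S (r y) l :=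
    fun y l => translateGL_smul_eq_splitPoints hf (h2 y) (h3 y) l
  have hC' : CrossRatiosTendsto F (fun y l => splitPoints S (r y) l) C := by
    simpa only [hZ] using hC.smul fun y => translateGL (t y (σ.symm f))
  have hinj : ∀ y, Function.Injective fun l => splitPoints S (r y) l := by
    intro y
    simp_rw [← hZ]
    exact (MulAction.injective _).comp (hz y)
  have hzS : ∀ y, ∀ l ∈ S, splitPoints S (r y) l = homog (r y l) 1 := fun y l hl => if_pos hl
  have hzO : ∀ y, ∀ l ∉ S, splitPoints S (r y) l = homog 1 (r y l) := fun y l hl => if_neg hl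
  have hre : ∀ y, r y e = 0 := fun y => by
    simp only [hrdef, splitCoords]
    rw [if_neg he, if_pos (by rw [hedef, Equiv.symm_apply_apply]; simp only; omega)]
  have hrf : ∀ y, r y f = 0 := fun y => by
    simp only [hrdef, splitCoords]
    rw [if_pos hf, sub_self]
  have hr : ∀ s ∈ S, ∀ o ∉ S, Tendsto (fun y => r y s * r y o) F (𝓝 0) := fun s hs o ho =>
    tendsto_mul_of_hasNode hvw hSv hinj hzS hzO hC' he hre hf hrf hj ha hb hab hN hs ho
  have hlim := exists_smul_tendsto_of_hasNode hvw hSv hOw hinj hzS hzO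
    (z' := fun y l => negateSplitPoints S (r y) l) (fun y l hl => if_pos hl)
    (fun y l hl => if_neg hl) hr hC' he hre hf hrf
  have hsmall : ∀ᶠ y in F, ∀ s ∈ S, ∀ o ∉ S, |r y s * r y o| < 1 := by
    refine eventually_all.2 fun s => eventually_imp_distrib_left.2 fun hs =>
      eventually_all.2 fun o => eventually_imp_distrib_left.2 fun ho => ?_
    have := (hr s hs o ho).abs
    rw [abs_zero] at this
    exact this.eventually_lt_const one_pos
  -- Only on this set, which is eventual along `F`, are the negated points known to be distinct and
  -- in the twisted cell.
  set T : Set (openCell σ) := {y | ∀ s ∈ S, ∀ o ∉ S, |r y s * r y o| < 1} with hT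
  have hTne : (comap ((↑) : T → openCell σ) F).NeBot := by
    rw [comap_neBot_iff_frequently]
    refine hsmall.frequently.mono fun y hy => ⟨⟨y, hy⟩, rfl⟩
  have hstd : ∀ y : T, ∃ g : GL (Fin 2) ℝ, IsStandard fun s => g •
      negateSplitPoints S (r y.1) (((flipSide d.1 d.2).symm.trans σ) s) := fun y =>
    exists_isStandard_negateSplitPoints hn hf (h2 y.1) y.2
  have hinj' : ∀ y : T, Function.Injective (negateSplitPoints S (r y.1)) := fun y => by
    obtain ⟨g, hg⟩ := hstd y
    exact injective_of_isStandard hg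
  refine mem_closure_of_tendsto (b := comap ((↑) : T → openCell σ) F)
    (f := fun y : T => mkOneBubble hn (negateSplitPoints S (r y.1)) (hinj' y)) ?_
    (Eventually.of_forall fun y => mkOneBubble_mem_openCell hn _ (hstd y))
  refine tendsto_mkOneBubble fun x => ?_
  obtain ⟨g, γ, hg⟩ := hlim x
  exact ⟨fun y => g y.1, γ, fun l q hq => (hg l q hq).comp tendsto_comap⟩

/-! ### Twists of polygons and the faces they represent. -/

namespace Polygon

variable {k : ℕ}

/-- A diagonal not crossing `d` lies in the reflected piece and moves with its sides, or it has the
whole piece on one side, and then the flip only permutes sides there. -/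
theorem cutLabels_flipDiag (σ : Fin n ≃ Fin n) {d e : Fin n × Fin n}
    (he : e.1.val < e.2.val) (hde : ¬ (d.1 < e.1 ∧ e.1 < d.2 ∧ d.2 < e.2))
    (hed : ¬ (e.1 < d.1 ∧ d.1 < e.2 ∧ e.2 < d.2)) :
    cutLabels ((flipSide d.1 d.2).symm.trans σ) (flipDiag d.1 d.2 e) = cutLabels σ e := by
  ext i
  have h1 := d.2.isLt
  have h2 := (σ.symm i).isLt
  simp only [Fin.lt_def] at hde hed
  simp only [cutLabels, flipDiag, flipSide, Set.mem_ofPred_eq, Equiv.symm_trans_apply,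
    Equiv.symm_symm, Equiv.coe_fn_mk, Fin.le_def, Fin.lt_def]
  split_ifs <;> (try simp only) <;> omega

/-- The twist of a labeled polygon along a diagonal represents the same face. -/
theorem face_twist (hn : 3 ≤ n) (G : Polygon n k) (d : Fin n × Fin n) (hd : d ∈ G.diagonals) :
    (G.twist d hd).face = G.face := by
  have hlt : ∀ e ∈ G.diagonals, e.1.val < e.2.val := fun e he => by
    have := G.nonadjacent e he
    omega
  have hcut : ∀ e ∈ G.diagonals, cutLabels (G.twist d hd).label (flipDiag d.1 d.2 e) =
      cutLabels G.label e := fun e he =>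
    cutLabels_flipDiag G.label (hlt e he) (G.noncrossing d hd e he)
      (G.noncrossing e he d hd)
  have hself : flipDiag d.1 d.2 d = d := by
    have := hlt d hd
    unfold flipDiag
    rw [dif_pos (by omega)]
    ext <;> simp
  have hcut' : cutLabels (G.twist d hd).label d = cutLabels G.label d := by
    rw [← hcut d hd, hself]
  have hnodes : ∀ x : Mbar n, (∀ e ∈ (G.twist d hd).diagonals,
      ∃ C : StableCurve n, (⟦C⟧ : Quotient (StableCurve.setoid n)) = x ∧
        C.HasNode (cutLabels (G.twist d hd).label e)) ↔
      ∀ e ∈ G.diagonals, ∃ C : StableCurve n, (⟦C⟧ : Quotient (StableCurve.setoid n)) = x ∧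
        C.HasNode (cutLabels G.label e) := by
    intro x
    simp only [show (G.twist d hd).diagonals = G.diagonals.image (flipDiag d.1 d.2) from rfl,
      Finset.forall_mem_image]
    refine forall₂_congr fun e he => ?_
    rw [hcut e he]
  -- Flipping twice restores the labeling, so both inclusions come from `mem_associahedron_flip`.
  have hinv : (flipSide d.1 d.2).symm.trans (G.twist d hd).label = G.label := by
    rw [show (G.twist d hd).label = (flipSide d.1 d.2).symm.trans G.label from rfl,
      ← Equiv.trans_assoc, show (flipSide d.1 d.2).symm.trans (flipSide d.1 d.2).symm =
        Equiv.refl _ from (flipSide d.1 d.2).self_trans_symm, Equiv.refl_trans]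
  ext x
  constructor
  · rintro ⟨hx, h⟩
    refine ⟨?_, (hnodes x).1 h⟩
    obtain ⟨C, rfl, hC⟩ := (hnodes x).1 h d hd
    rw [← hcut'] at hC
    rw [← hinv]
    exact mem_associahedron_flip hn hx hC
  · rintro ⟨hx, h⟩
    refine ⟨?_, (hnodes x).2 h⟩
    obtain ⟨C, rfl, hC⟩ := h d hd
    exact mem_associahedron_flip hn hx hC

end Polygon

end Mosaic

/-- Two labeled `n`-gons with `k` diagonals, which represent codimension `k` faces of associahedra,
are identified in the moduli space if one is obtained from the other by a sequence of twists along
diagonals. -/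
theorem proposition3p1p2 (n k : ℕ) (hn : 3 ≤ n) (G₁ G₂ : Mosaic.LabeledPolygon n k)
    (h : Relation.ReflTransGen Mosaic.LabeledPolygon.IsTwist G₁ G₂) :
    G₁.face = G₂.face := by
  induction h with
  | refl => rfl
  | tail _ hst ih =>
    obtain ⟨P, d, hd, rfl, rfl⟩ := hst
    exact ih.trans (P.face_twist hn d hd).symm
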